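/- Words are one-sided infinite. For an infinite word $x=x_0x_1x_2\cdots$ let $\mathcal L(x)$ denote the set of its factors (finite blocks of consecutive letters), and let its factor complexity be the function counting, for each $n$, the factors of length $n$. Two finite words are abelian equivalent if every letter occurs equally often in both. For a word $x\in\Sigma^{\mathbb N}$ over a finite alphabet $\Sigma$, the orbit closure of $x$ is $\Omega(x)=\{y\in\Sigma^{\mathbb N}:\mathcal L(y)\subseteq\mathcal L(x)\}$, and the abelian closure $\mathcal A(x)$ is the set of all $y\in\Sigma^{\mathbb N}$ such that every factor of $y$ is abelian equivalent to some factor of $x$. A subshift is a non-empty closed subset $X$ of $\Sigma^{\mathbb N}$ (with the product topology of the discrete topology on $\Sigma$) with $\sigma(X)\subseteq X$, where $\sigma$ is the shift $\sigma(x)_i=x_{i+1}$; it is minimal if it contains no proper subshift. A Sturmian word is a word $s\in\{0,1\}^{\mathbb N}$ with exactly $n+1$ factors of length $n$ for every $n\ge 0$. Theorem. Let $u\in\{0,1,2\}^{\mathbb N}$ have exactly $n+2$ factors of length $n$ for every $n\ge 1$. (a) If, up to a permutation of the letters $0,1,2$, either $u=2s$ for some Sturmian word $s\in\{0,1\}^{\mathbb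 N}$, or $u\in\Omega(\varphi(s))$ for some Sturmian word $s$ and the morphism $\varphi:0\mapsto 02,\ 1\mapsto 12$, then $\mathcal A(u)=\Omega(u)$. (b) If, up to a permutation of the letters $0,1,2$, $u\in\Omega(\psi(s))$ for some Sturmian word $s$ and the morphism $\psi:0\mapsto 0,\ 1\mapsto 12$, then the set of minimal subshifts contained in $\mathcal A(u)$ is uncountable. -/

import Mathlib

/-! One-sided infinite words over an alphabet `A` are functions `ℕ → A`; finite words are lists. -/

namespace InfWord

/-- The block of length `n` of the infinite word `x` starting at position `k`. -/
def block {A : Type*} (x : ℕ → A) (k n : ℕ) : List A :=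
  (List.range n).map fun i => x (k + i)

/-- The language of `x`: the set of its factors (the empty word included). -/
def language {A : Type*} (x : ℕ → A) : Set (List A) :=
  {w | ∃ k n : ℕ, w = block x k n}

/-- The factor complexity of `x`: the number of factors of length `n`. -/
noncomputable def complexity {A : Type*} (x : ℕ → A) (n : ℕ) : ℕ :=
  Set.ncard {w | w ∈ language x ∧ w.length = n}

/-- Two finite words are abelian equivalent if each letter occurs equally often in both. -/
def AbelianEquiv {A : Type*} [DecidableEq A] (u v : List A) : Prop :=
  ∀ a : A, u.count a = v.count a

/-- The abelian closure of `x`. -/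
def abelianClosure {A : Type*} [DecidableEq A] (x : ℕ → A) : Set (ℕ → A) :=
  {y | ∀ u ∈ language y, ∃ v ∈ language x, AbelianEquiv u v}

/-- The shift orbit closure of `x`: all words whose factors are factors of `x`. -/
def orbitClosure {A : Type*} (x : ℕ → A) : Set (ℕ → A) :=
  {y | language y ⊆ language x}

/-- The shift map. -/
def shift {A : Type*} (x : ℕ → A) : ℕ → A := fun n => x (n + 1)

/-- A subshift: a non-empty set of words that is closed in the product topology
(of the discrete topology on the alphabet) and mapped into itself by the shift. -/
def IsSubshift {A : Type*} [TopologicalSpace A] [DiscreteTopology A] (X : Set (ℕ → A)) : Prop :=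
  X.Nonempty ∧ IsClosed X ∧ ∀ x ∈ X, shift x ∈ X

/-- A minimal subshift: a subshift that contains no proper subshift. -/
def IsMinimalSubshift {A : Type*} [TopologicalSpace A] [DiscreteTopology A]
    (X : Set (ℕ → A)) : Prop :=
  IsSubshift X ∧ ∀ Y : Set (ℕ → A), IsSubshift Y → Y ⊆ X → Y = X

/-- A Sturmian word: a binary word with exactly `n + 1` factors of each length `n`
(such a word is automatically aperiodic). -/
def IsSturmian (s : ℕ → Fin 2) : Prop :=
  ∀ n : ℕ, complexity s n = n + 1

/-- The infinite word `a x`. -/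
def cons {A : Type*} (a : A) (x : ℕ → A) : ℕ → A
  | 0 => a
  | n + 1 => x n

theorem le_length_flatMap {A B : Type*} (φ : A → List B) (hφ : ∀ a, φ a ≠ []) (l : List A) :
    l.length ≤ (l.flatMap φ).length := by
  induction l with
  | nil => simp
  | cons a l ih =>
    have h : 0 < (φ a).length := List.length_pos_iff.mpr (hφ a)
    simp only [List.length_cons, List.flatMap_cons, List.length_append]
    omega

/-- The image `φ(x₀) φ(x₁) φ(x₂) ⋯` of an infinite word `x` under a non-erasing morphism `φ`: its
letter at position `n` is read off the finite word `φ(x₀) ⋯ φ(xₙ)`, whose length exceeds `n`. -/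
def morphicImage {A B : Type*} (φ : A → List B) (hφ : ∀ a, φ a ≠ []) (x : ℕ → A) : ℕ → B :=
  fun n => ((block x 0 (n + 1)).flatMap φ)[n]'(by
    have h := le_length_flatMap φ hφ (block x 0 (n + 1))
    simp only [block, List.length_map, List.length_range] at h ⊢
    omega)

/-- The morphism `0 ↦ 02`, `1 ↦ 12`. -/
def morphA : Fin 2 → List (Fin 3) := ![[0, 2], [1, 2]]

/-- The morphism `0 ↦ 0`, `1 ↦ 12`. -/
def morphB : Fin 2 → List (Fin 3) := ![[0], [1, 2]]

theorem morphA_ne_nil : ∀ a, morphA a ≠ [] := by decide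

theorem morphB_ne_nil : ∀ a, morphB a ≠ [] := by decide

/-- `u = 2s` with `s` a Sturmian word over `{0, 1}`. -/
def IsTypeOne (u : ℕ → Fin 3) : Prop :=
  ∃ s : ℕ → Fin 2, IsSturmian s ∧ u = cons 2 fun n => (s n).castSucc

/-- `u` lies in the orbit closure of the image of a Sturmian word under `0 ↦ 02`, `1 ↦ 12`. -/
def IsTypeTwo (u : ℕ → Fin 3) : Prop :=
  ∃ s : ℕ → Fin 2, IsSturmian s ∧ u ∈ orbitClosure (morphicImage morphA morphA_ne_nil s)

/-- `u` lies in the orbit closure of the image of a Sturmian word under `0 ↦ 0`, `1 ↦ 12`. -/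
def IsTypeThree (u : ℕ → Fin 3) : Prop :=
  ∃ s : ℕ → Fin 2, IsSturmian s ∧ u ∈ orbitClosure (morphicImage morphB morphB_ne_nil s)

/-- `u` has property `P` after some permutation of the letters. -/
def UpToPerm (P : (ℕ → Fin 3) → Prop) (u : ℕ → Fin 3) : Prop :=
  ∃ π : Equiv.Perm (Fin 3), P fun n => π (u n)

end InfWord

/-! Part (a) rests on the binary case: a Sturmian word is balanced (`IsSturmian.balanced`), and a
balanced factorial language has at most `n + 1` words of each length (`ncard_le_of_balanced`).
Adjoining the factors of a word of the abelian closure keeps the language balanced, hence adds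
nothing, and `IsSturmian.abelianClosure_eq` follows. For `2s`, the single `2` marks the beginning,
so a word of the closure containing `2` must be `2s` itself. In the alternating case, erasing the
`2`s reduces the question to a binary word, which the complexity hypothesis makes Sturmian.

In part (b) the `2`s are exactly the letters following the `1`s, so the `2`-count of a window is the
`1`-count of the window one place earlier. The `1`s form a Sturmian word of irrational slope `γ <
1/2`. On the circle, the `1`s and `2`s are codings by two arcs of length `γ`, one a translate of the
other. Abelian counts do not detect the translation: for every offset `δ` in `[γ, 1 - γ]`, which
keeps the arcs disjoint, the coding `rotWord γ δ` stays in the abelian closure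
(`rotWord_mem_abelianClosure`). These words are uniformly recurrent, and different offsets give
different orbit closures (`rotWord_ne_of_lt`), whence uncountably many minimal subshifts.

Of the morphisms, only the local rules on adjacent letters are used; the rest comes from the
complexity of `u`. -/

namespace InfWord

/-! ### Factors, complexity and eventual periodicity. -/

section Blocks

variable {A : Type*}

@[simp] theorem length_block (x : ℕ → A) (k n : ℕ) : (block x k n).length = n := by
  simp [block]

theorem block_eq_block_iff {x y : ℕ → A} {j k n : ℕ} :
    block x j n = block y k n ↔ ∀ i < n, x (j + i) = y (k + i) := by
  simp [block, List.map_inj_left]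

theorem block_succ (x : ℕ → A) (k n : ℕ) : block x k (n + 1) = block x k n ++ [x (k + n)] := by
  simp [block, List.range_succ]

theorem block_succ_left (x : ℕ → A) (k n : ℕ) :
    block x k (n + 1) = x k :: block x (k + 1) n := by
  simp only [block, List.range_succ_eq_map, List.map_cons, List.map_map, Nat.add_zero]
  congr 1
  apply List.map_congr_left
  intro i _
  simp only [Function.comp]
  congr 1
  omega

@[simp] theorem block_zero (x : ℕ → A) (k : ℕ) : block x k 0 = [] := rfl

theorem block_shift (x : ℕ → A) (k n : ℕ) : block (shift x) k n = block x (k + 1) n := by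
  simp only [block, shift]
  apply List.map_congr_left
  intro i _
  congr 1
  omega

theorem block_comp {B : Type*} (f : A → B) (x : ℕ → A) (k n : ℕ) :
    block (fun i => f (x i)) k n = (block x k n).map f := by
  simp [block]

theorem block_mem_language (x : ℕ → A) (k n : ℕ) : block x k n ∈ language x := ⟨k, n, rfl⟩

/-- The factors of length `n` of an infinite word. -/
def factors (x : ℕ → A) (n : ℕ) : Set (List A) := Set.range fun k => block x k n

theorem setOf_mem_language_length (x : ℕ → A) (n : ℕ) :
    {w | w ∈ language x ∧ w.length = n} = factors x n := by
  ext w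
  constructor
  · rintro ⟨⟨k, m, rfl⟩, h⟩
    rw [length_block] at h
    subst h
    exact ⟨k, rfl⟩
  · rintro ⟨k, rfl⟩
    exact ⟨block_mem_language x k n, length_block x k n⟩

theorem complexity_eq (x : ℕ → A) (n : ℕ) : complexity x n = (factors x n).ncard := by
  rw [complexity, setOf_mem_language_length]

theorem language_subset_iff {x y : ℕ → A} :
    language y ⊆ language x ↔ ∀ n, factors y n ⊆ factors x n := by
  constructor
  · rintro h n _ ⟨k, rfl⟩
    rw [← setOf_mem_language_length]
    exact ⟨h (block_mem_language y k n), length_block y k n⟩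
  · rintro h _ ⟨k, n, rfl⟩
    obtain ⟨j, hj⟩ := h n ⟨k, rfl⟩
    exact ⟨j, n, hj.symm⟩

theorem mem_orbitClosure_iff {x y : ℕ → A} :
    y ∈ orbitClosure x ↔ ∀ k n, ∃ j, ∀ i < n, y (k + i) = x (j + i) := by
  rw [orbitClosure, Set.mem_ofPred_eq, language_subset_iff]
  constructor
  · intro h k n
    obtain ⟨j, hj⟩ := h n ⟨k, rfl⟩
    exact ⟨j, block_eq_block_iff.1 hj.symm⟩
  · rintro h n _ ⟨k, rfl⟩
    obtain ⟨j, hj⟩ := h k n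
    exact ⟨j, (block_eq_block_iff.2 hj).symm⟩

theorem factors_finite [Finite A] (x : ℕ → A) (n : ℕ) : (factors x n).Finite :=
  (List.finite_length_eq A n).subset (by rintro _ ⟨k, rfl⟩; exact length_block x k n)

theorem factors_shift_subset (x : ℕ → A) (n : ℕ) : factors (shift x) n ⊆ factors x n := by
  rintro _ ⟨k, rfl⟩
  exact ⟨k + 1, (block_shift x k n).symm⟩

@[simp] theorem complexity_zero (x : ℕ → A) : complexity x 0 = 1 := by
  rw [complexity_eq, Set.ncard_eq_one]
  exact ⟨[], by ext w; simp [factors]⟩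

theorem factors_comp {B : Type*} (f : A → B) (x : ℕ → A) (n : ℕ) :
    factors (fun i => f (x i)) n = List.map f '' factors x n := by
  ext w
  simp [factors, block_comp]

theorem complexity_comp {B : Type*} {f : A → B} (hf : Function.Injective f) (x : ℕ → A) (n : ℕ) :
    complexity (fun i => f (x i)) n = complexity x n := by
  rw [complexity_eq, complexity_eq, factors_comp]
  exact Set.ncard_image_of_injective _ (List.map_injective_iff.2 hf)

theorem comp_mem_orbitClosure_iff {B : Type*} {f : A → B} (hf : Function.Injective f)
    {x y : ℕ → A} :
    (fun i => f (y i)) ∈ orbitClosure (fun i => f (x i)) ↔ y ∈ orbitClosure x := by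
  simp only [mem_orbitClosure_iff, hf.eq_iff]

/-- A word is eventually periodic if some shift of it is periodic. -/
def EventuallyPeriodic (x : ℕ → A) : Prop := ∃ N p, 0 < p ∧ ∀ i ≥ N, x (i + p) = x i

theorem EventuallyPeriodic.exists_complexity_le {x : ℕ → A} (h : EventuallyPeriodic x) :
    ∃ C, ∀ n, complexity x n ≤ C := by
  obtain ⟨N, p, hp, h⟩ := h
  refine ⟨N + p, fun n => ?_⟩
  have key : ∀ k, ∃ j < N + p, block x k n = block x j n := by
    intro k
    induction k using Nat.strong_induction_on with
    | _ k ih =>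
      by_cases hk : k < N + p
      · exact ⟨k, hk, rfl⟩
      · obtain ⟨j, hj, e⟩ := ih (k - p) (by omega)
        refine ⟨j, hj, ?_⟩
        rw [← e, block_eq_block_iff]
        intro i _
        rw [← h (k - p + i) (by omega)]
        congr 1
        omega
  have hsub : factors x n ⊆ (fun k => block x k n) '' (Finset.range (N + p) : Set ℕ) := by
    rintro _ ⟨k, rfl⟩
    obtain ⟨j, hj, e⟩ := key k
    exact ⟨j, by simpa using hj, e.symm⟩
  rw [complexity_eq]
  refine (Set.ncard_le_ncard hsub ((Finset.finite_toSet _).image _)).trans ?_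
  refine (Set.ncard_image_le (Finset.finite_toSet _)).trans ?_
  simp

theorem not_eventuallyPeriodic_of_le_complexity {x : ℕ → A}
    (h : ∀ n, 1 ≤ n → n + 1 ≤ complexity x n) : ¬ EventuallyPeriodic x := by
  intro hx
  obtain ⟨C, hC⟩ := hx.exists_complexity_le
  have h1 := h (C + 1) (by omega)
  have h2 := hC (C + 1)
  omega

/-- If, among the blocks of length `n` from position `i` on, equal blocks are followed by equal
letters, then a repetition of such a block makes the word eventually periodic. -/
theorem eventuallyPeriodic_of_repetition {x : ℕ → A} {n i j : ℕ} (hij : i < j)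
    (h : block x i n = block x j n)
    (hdet : ∀ k, (∀ l ≤ k, block x (i + l) n = block x (j + l) n) →
      x (i + k + n) = x (j + k + n)) : EventuallyPeriodic x := by
  have key : ∀ k, ∀ l ≤ k, block x (i + l) n = block x (j + l) n := by
    intro k
    induction k with
    | zero =>
      intro l hl
      obtain rfl : l = 0 := by omega
      exact h
    | succ k ih =>
      intro l hl
      rcases Nat.lt_or_ge l (k + 1) with hl' | hl'
      · exact ih l (by omega)
      · obtain rfl : l = k + 1 := by omega
        have h1 := block_eq_block_iff.1 (ih k le_rfl)
        rw [block_eq_block_iff]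
        intro m hm
        rcases Nat.lt_or_ge (m + 1) n with hm' | hm'
        · have := h1 (m + 1) hm'
          convert this using 2 <;> omega
        · convert hdet k ih using 2 <;> omega
  refine ⟨i + n, j - i, by omega, fun m hm => ?_⟩
  have := hdet (m - (i + n)) (key _)
  convert this.symm using 2 <;> omega

/-- Morse–Hedlund: without growth, truncation is injective on factors of length `n + 1`, so each
block determines its next letter, and by pigeonhole some block repeats. -/
theorem complexity_lt_succ [Finite A] {x : ℕ → A} (hx : ¬ EventuallyPeriodic x) (n : ℕ) :
    complexity x n < complexity x (n + 1) := by
  by_contra! hle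
  rw [complexity_eq, complexity_eq] at hle
  have himg : List.take n '' factors x (n + 1) = factors x n := by
    ext w
    simp only [factors, Set.mem_image, Set.mem_range, exists_exists_eq_and, block_succ]
    constructor
    · rintro ⟨k, rfl⟩
      exact ⟨k, by simp⟩
    · rintro ⟨k, rfl⟩
      exact ⟨k, by simp⟩
  have hinj : Set.InjOn (List.take n) (factors x (n + 1)) := by
    apply Set.injOn_of_ncard_image_eq _ (factors_finite x (n + 1))
    rw [himg]
    refine le_antisymm ?_ hle
    rw [← himg]
    exact Set.ncard_image_le (factors_finite x (n + 1))
  obtain ⟨i, -, j, -, hne, e⟩ := Set.infinite_univ.exists_ne_map_eq_of_mapsTo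
    (f := fun k => block x k n) (t := factors x n) (fun k _ => ⟨k, rfl⟩) (factors_finite x n)
  wlog hij : i < j generalizing i j
  · exact this j i hne.symm e.symm (by omega)
  refine hx (eventuallyPeriodic_of_repetition hij e fun k hk => ?_)
  have h1 := hinj ⟨i + k, rfl⟩ ⟨j + k, rfl⟩ (by simpa [block_succ] using hk k le_rfl)
  exact block_eq_block_iff.1 h1 n (by omega)

theorem succ_le_complexity [Finite A] {x : ℕ → A} (hx : ¬ EventuallyPeriodic x) (n : ℕ) :
    n + 1 ≤ complexity x n := by
  induction n with
  | zero => simp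
  | succ n ih => exact Nat.succ_le_of_lt (lt_of_le_of_lt ih (complexity_lt_succ hx n))

/-- Strict growth propagates the upper bound down from length `n + 2` to length `n`, so lengths
below 2 need no separate check. -/
theorem isSturmian_of_complexity_le {s : ℕ → Fin 2} (hs : ¬ EventuallyPeriodic s)
    (h : ∀ n, 2 ≤ n → complexity s n ≤ n + 1) : IsSturmian s := by
  intro n
  have h0 := succ_le_complexity hs n
  have h1 := complexity_lt_succ hs n
  have h2 : complexity s (n + 1) < complexity s (n + 2) := complexity_lt_succ hs (n + 1)
  have h3 := h (n + 2) (by omega)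
  omega

theorem IsSturmian.not_eventuallyPeriodic {s : ℕ → Fin 2} (hs : IsSturmian s) :
    ¬ EventuallyPeriodic s :=
  not_eventuallyPeriodic_of_le_complexity fun n _ => (hs n).ge

theorem EventuallyPeriodic.of_shift {x : ℕ → A} (h : EventuallyPeriodic (shift x)) :
    EventuallyPeriodic x := by
  obtain ⟨N, p, hp, h⟩ := h
  refine ⟨N + 1, p, hp, fun i hi => ?_⟩
  have := h (i - 1) (by omega)
  simp only [shift] at this
  convert this using 2 <;> omega

theorem IsSturmian.shift_isSturmian {s : ℕ → Fin 2} (hs : IsSturmian s) :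
    IsSturmian (shift s) := by
  refine isSturmian_of_complexity_le (fun h => hs.not_eventuallyPeriodic h.of_shift) fun n _ => ?_
  rw [← hs n, complexity_eq, complexity_eq]
  exact Set.ncard_le_ncard (factors_shift_subset s n) (factors_finite s n)

/-- Every factor of a Sturmian word occurs at a positive position. -/
theorem IsSturmian.factors_shift {s : ℕ → Fin 2} (hs : IsSturmian s) (n : ℕ) :
    factors (shift s) n = factors s n := by
  apply Set.eq_of_subset_of_ncard_le (factors_shift_subset s n) _ (factors_finite s n)
  rw [← complexity_eq, ← complexity_eq, hs n, hs.shift_isSturmian n]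

end Blocks

/-! ### Letter counts and the abelian closure. -/

section Count

variable {A : Type*} [DecidableEq A]

theorem count_block_succ (a : A) (x : ℕ → A) (k n : ℕ) :
    (block x k (n + 1)).count a = (block x k n).count a + if x (k + n) = a then 1 else 0 := by
  rw [block_succ, List.count_append, List.count_singleton]
  simp [beq_iff_eq]

theorem count_block_succ_left (a : A) (x : ℕ → A) (k n : ℕ) :
    (block x k (n + 1)).count a = (if x k = a then 1 else 0) + (block x (k + 1) n).count a := by
  rw [block_succ_left, List.count_cons]
  simp [beq_iff_eq, add_comm]

theorem count_block_add (a : A) (x : ℕ → A) (k m n : ℕ) :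
    (block x k (m + n)).count a = (block x k m).count a + (block x (k + m) n).count a := by
  induction n with
  | zero => simp
  | succ n ih =>
    rw [← add_assoc, count_block_succ, count_block_succ, ih]
    simp [add_assoc]

theorem mem_abelianClosure_iff {x y : ℕ → A} :
    y ∈ abelianClosure x ↔
      ∀ k n, ∃ j, ∀ a, (block y k n).count a = (block x j n).count a := by
  constructor
  · intro h k n
    obtain ⟨_, ⟨j, m, rfl⟩, e⟩ := h _ (block_mem_language y k n)
    have hp : (block y k n).Perm (block x j m) := List.perm_iff_count.2 e
    have hl := hp.length_eq
    rw [length_block, length_block] at hl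
    subst hl
    exact ⟨j, e⟩
  · rintro h _ ⟨k, n, rfl⟩
    obtain ⟨j, e⟩ := h k n
    exact ⟨_, block_mem_language x j n, e⟩

theorem orbitClosure_subset_abelianClosure (x : ℕ → A) : orbitClosure x ⊆ abelianClosure x :=
  fun _ hy w hw => ⟨w, hy hw, fun _ => rfl⟩

theorem comp_mem_abelianClosure {B : Type*} [DecidableEq B] {f : A → B}
    {x y : ℕ → A} (h : y ∈ abelianClosure x) :
    (fun i => f (y i)) ∈ abelianClosure (fun i => f (x i)) := by
  rw [mem_abelianClosure_iff] at h ⊢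
  intro k n
  obtain ⟨j, e⟩ := h k n
  refine ⟨j, ?_⟩
  rw [block_comp f y, block_comp f x]
  exact List.perm_iff_count.1 ((List.perm_iff_count.2 e).map f)

theorem count_add_count_add_count (w : List (Fin 3)) :
    w.count 0 + w.count 1 + w.count 2 = w.length := by
  induction w with
  | nil => rfl
  | cons a w ih => fin_cases a <;> simp <;> omega

end Count

/-! ### Right special factors and balance of Sturmian words. -/

theorem fin_two_eq_iff {a b : Fin 2} : a = b ↔ (a = 1 ↔ b = 1) := by
  revert a b; decide

theorem count_block_eq_of_reverse {A : Type*} [DecidableEq A] (c : A) {x : ℕ → A} {k a b : ℕ}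
    (h : ∀ i < k, x (a + i) = x (b + (k - 1 - i))) :
    (block x a k).count c = (block x b k).count c := by
  induction k generalizing b with
  | zero => simp
  | succ k ih =>
    rw [count_block_succ, count_block_succ_left, ih (b := b + 1), h k (by omega), add_comm]
    · congr 3
      simp
    · intro i hi
      rw [h i (by omega)]
      congr 1
      omega

/-- The words `w` of length `n` for which `w0` and `w1` are both factors of `s`. -/
def rightSpecial (s : ℕ → Fin 2) (n : ℕ) : Set (List (Fin 2)) :=
  {w | w ++ [0] ∈ factors s (n + 1)} ∩ {w | w ++ [1] ∈ factors s (n + 1)}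

theorem append_mem_factors_succ {s : ℕ → Fin 2} {n : ℕ} {w : List (Fin 2)} {a : Fin 2} :
    w ++ [a] ∈ factors s (n + 1) ↔ ∃ k, block s k n = w ∧ s (k + n) = a := by
  simp [factors, block_succ]

/-- The sets of words extendable by `0` and by `1` have sizes adding up to `n + 2`, while their
union has `n + 1` elements. -/
theorem IsSturmian.ncard_rightSpecial {s : ℕ → Fin 2} (hs : IsSturmian s) (n : ℕ) :
    (rightSpecial s n).ncard = 1 := by
  set B : Fin 2 → Set (List (Fin 2)) := fun a => {w | w ++ [a] ∈ factors s (n + 1)} with hB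
  have hmem : ∀ a w, w ∈ B a ↔ ∃ k, block s k n = w ∧ s (k + n) = a := fun a w =>
    append_mem_factors_succ
  have hunion : B 0 ∪ B 1 = factors s n := by
    ext w
    rw [Set.mem_union, hmem, hmem]
    constructor
    · rintro (⟨k, h, -⟩ | ⟨k, h, -⟩) <;> exact ⟨k, h⟩
    · rintro ⟨k, h⟩
      rcases Fin.exists_fin_two.1 ⟨s (k + n), rfl⟩ with h0 | h1
      · exact Or.inl ⟨k, h, h0⟩
      · exact Or.inr ⟨k, h, h1⟩
  have hfin : ∀ a, (B a).Finite := fun a => (factors_finite s n).subset <| by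
    intro w hw
    obtain ⟨k, h, -⟩ := (hmem a w).1 hw
    exact ⟨k, h⟩
  have hinj : ∀ a : Fin 2, Function.Injective fun w : List (Fin 2) => w ++ [a] :=
    fun a => List.append_left_injective [a]
  have himg : (fun w => w ++ [(0 : Fin 2)]) '' B 0 ∪ (fun w => w ++ [(1 : Fin 2)]) '' B 1 =
      factors s (n + 1) := by
    ext w
    constructor
    · rintro (⟨w, h, rfl⟩ | ⟨w, h, rfl⟩) <;> exact h
    · rintro ⟨k, rfl⟩
      simp only [block_succ]
      rcases Fin.exists_fin_two.1 ⟨s (k + n), rfl⟩ with h0 | h1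
      · exact Or.inl ⟨_, (hmem _ _).2 ⟨k, rfl, h0⟩, by simp [h0]⟩
      · exact Or.inr ⟨_, (hmem _ _).2 ⟨k, rfl, h1⟩, by simp [h1]⟩
  have hdisj : Disjoint ((fun w => w ++ [(0 : Fin 2)]) '' B 0)
      ((fun w => w ++ [(1 : Fin 2)]) '' B 1) := by
    rw [Set.disjoint_left]
    rintro _ ⟨w, -, rfl⟩ ⟨w', -, h⟩
    simp at h
  have h1 := Set.ncard_union_eq hdisj ((hfin 0).image _) ((hfin 1).image _)
  rw [himg, Set.ncard_image_of_injective _ (hinj 0), Set.ncard_image_of_injective _ (hinj 1),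
    ← complexity_eq, hs] at h1
  have h2 := Set.ncard_union_add_ncard_inter (B 0) (B 1) (hfin 0) (hfin 1)
  rw [hunion, ← complexity_eq, hs] at h2
  change (B 0 ∩ B 1).ncard = 1
  omega

theorem mem_rightSpecial_of_ne {s : ℕ → Fin 2} {n j k : ℕ} (h : block s j n = block s k n)
    (hne : s (j + n) ≠ s (k + n)) : block s j n ∈ rightSpecial s n := by
  have h1 : ∀ a b : Fin 2, a ≠ b → (a = 0 ∧ b = 1) ∨ (a = 1 ∧ b = 0) := by decide
  rcases h1 _ _ hne with ⟨e1, e2⟩ | ⟨e1, e2⟩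
  · exact ⟨append_mem_factors_succ.2 ⟨j, rfl, e1⟩, append_mem_factors_succ.2 ⟨k, h.symm, e2⟩⟩
  · exact ⟨append_mem_factors_succ.2 ⟨k, h.symm, e2⟩, append_mem_factors_succ.2 ⟨j, rfl, e1⟩⟩

theorem exists_of_mem_rightSpecial {s : ℕ → Fin 2} {n : ℕ} {w : List (Fin 2)}
    (h : w ∈ rightSpecial s n) :
    ∃ j k, block s j n = w ∧ block s k n = w ∧ s (j + n) ≠ s (k + n) := by
  obtain ⟨j, hj, ej⟩ := append_mem_factors_succ.1 h.1
  obtain ⟨k, hk, ek⟩ := append_mem_factors_succ.1 h.2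
  exact ⟨j, k, hj, hk, by rw [ej, ek]; decide⟩

/-- A shortest unbalanced pair of blocks has the form `0w0`, `1w1` with `w` a palindrome. -/
theorem exists_palindrome_of_unbalanced {s : ℕ → Fin 2} {N p q : ℕ}
    (hpq : (block s p N).count 1 + 2 ≤ (block s q N).count 1)
    (hmin : ∀ m < N, ∀ k l, (block s k m).count 1 ≤ (block s l m).count 1 + 1) :
    2 ≤ N ∧ s p = 0 ∧ s q = 1 ∧ s (p + (N - 1)) = 0 ∧ s (q + (N - 1)) = 1 ∧
      (∀ k, 1 ≤ k → k + 1 < N → s (p + k) = s (q + k)) ∧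
      ∀ k, 1 ≤ k → k + 1 < N → s (q + k) = s (q + (N - 1 - k)) := by
  have hN : 2 ≤ N := by
    have := (block s q N).count_le_length (a := 1)
    rw [length_block] at this
    omega
  -- The total surplus is at least 2, and minimality allows a proper prefix or suffix a surplus of
  -- at most 1, so each has surplus exactly 1.
  have hpre : ∀ k, 1 ≤ k → k < N →
      (block s q k).count 1 = (block s p k).count 1 + 1 ∧
      (block s (q + k) (N - k)).count 1 = (block s (p + k) (N - k)).count 1 + 1 := by
    intro k h1 h2
    have e1 := count_block_add 1 s q k (N - k)
    have e2 := count_block_add 1 s p k (N - k)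
    rw [show k + (N - k) = N by omega] at e1 e2
    have h3 := hmin k h2 q p
    have h4 := hmin (N - k) (by omega) (q + k) (p + k)
    omega
  have hends : (s p ≠ 1 ∧ s q = 1) ∧ (s (p + (N - 1)) ≠ 1 ∧ s (q + (N - 1)) = 1) := by
    constructor
    · have h := (hpre 1 le_rfl (by omega)).1
      rw [count_block_succ, count_block_succ] at h
      by_cases h1 : s p = 1 <;> by_cases h2 : s q = 1 <;> simp_all
    · have h := (hpre (N - 1) (by omega) (by omega)).2
      rw [show N - (N - 1) = 0 + 1 by omega, count_block_succ, count_block_succ] at h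
      by_cases h1 : s (p + (N - 1)) = 1 <;> by_cases h2 : s (q + (N - 1)) = 1 <;> simp_all
  have hne : ∀ a : Fin 2, a ≠ 1 → a = 0 := by decide
  have hmid : ∀ k, 1 ≤ k → k + 1 < N → s (p + k) = s (q + k) := by
    intro k h1 h2
    have e1 := (hpre k h1 (by omega)).1
    have e2 := (hpre (k + 1) (by omega) h2).1
    rw [count_block_succ, count_block_succ] at e2
    rw [fin_two_eq_iff]
    by_cases h3 : s (p + k) = 1 <;> by_cases h4 : s (q + k) = 1 <;> simp_all
  refine ⟨hN, hne _ hends.1.1, hends.1.2, hne _ hends.2.1, hends.2.2, hmid, ?_⟩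
  intro k
  induction k using Nat.strong_induction_on with
  | _ k ih =>
    intro h1 h2
    -- By induction the outer `k` letters on both sides mirror each other. If the next two letters
    -- differed, a prefix of one block and a suffix of the other, both of length `k + 1 < N`, would
    -- differ by 2.
    have hrev : (block s (q + (N - k)) k).count 1 = (block s q k).count 1 := by
      apply count_block_eq_of_reverse
      intro i hi
      rcases Nat.eq_zero_or_pos (k - 1 - i) with h | h
      · rw [h, Nat.add_zero, hends.1.2, ← hends.2.2]
        congr 1
        omega
      · rw [ih (k - 1 - i) (by omega) h (by omega)]
        congr 1
        omega
    have e1 := hpre k h1 (by omega)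
    have e2 := (hpre (N - k) (by omega) (by omega)).2
    rw [show N - (N - k) = k by omega] at e2
    have e3 := hmid k h1 h2
    have e4 := hmid (N - 1 - k) (by omega) (by omega)
    have f1 := count_block_succ 1 s p k
    have f2 := count_block_succ 1 s q k
    have f3 := count_block_succ_left 1 s (q + (N - 1 - k)) k
    have f4 := count_block_succ_left 1 s (p + (N - 1 - k)) k
    rw [show q + (N - 1 - k) + 1 = q + (N - k) by omega] at f3
    rw [show p + (N - 1 - k) + 1 = p + (N - k) by omega] at f4
    have g1 := hmin (k + 1) h2 (q + (N - 1 - k)) p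
    have g2 := hmin (k + 1) h2 q (p + (N - 1 - k))
    rw [e3] at f1
    rw [e4] at f4
    rw [fin_two_eq_iff]
    by_cases h3 : s (q + k) = 1 <;> by_cases h4 : s (q + (N - 1 - k)) = 1 <;>
      simp only [h3, h4, if_true, if_false] at f1 f2 f3 f4 ⊢ <;> omega

/-- Sturmian words are balanced. -/
theorem IsSturmian.balanced {s : ℕ → Fin 2} (hs : IsSturmian s) (k l n : ℕ) :
    (block s k n).count 1 ≤ (block s l n).count 1 + 1 := by
  classical
  by_contra hcon
  have hex : ∃ n, ∃ p q, (block s p n).count 1 + 2 ≤ (block s q n).count 1 :=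
    ⟨n, l, k, by omega⟩
  obtain ⟨p, q, hpq⟩ := Nat.find_spec hex
  have hmin : ∀ m < Nat.find hex, ∀ k l, (block s k m).count 1 ≤ (block s l m).count 1 + 1 := by
    intro m hm k l
    by_contra h
    exact Nat.find_min hex hm ⟨l, k, by omega⟩
  obtain ⟨hN, hp, hq, hp', hq', hmid, hpal⟩ := exists_palindrome_of_unbalanced hpq hmin
  obtain ⟨n, hn⟩ : ∃ n, Nat.find hex = n + 2 := ⟨_, (Nat.sub_add_cancel hN).symm⟩
  rw [hn] at hp' hq' hmid hpal
  rw [show n + 2 - 1 = n + 1 by omega] at hp' hq'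
  obtain ⟨v, hv⟩ := Set.ncard_eq_one.1 (hs.ncard_rightSpecial (n + 1))
  obtain ⟨w, hw⟩ := Set.ncard_eq_one.1 (hs.ncard_rightSpecial n)
  have hvmem : v ∈ rightSpecial s (n + 1) := hv ▸ rfl
  obtain ⟨r, r', hr, hr', hrr⟩ := exists_of_mem_rightSpecial hvmem
  have hwp : block s (p + 1) n = block s (q + 1) n := block_eq_block_iff.2 fun i hi => by
    have := hmid (i + 1) (by omega) (by omega)
    convert this using 2 <;> omega
  have hw1 : block s (p + 1) n = w := by
    have : block s (p + 1) n ∈ rightSpecial s n := by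
      apply mem_rightSpecial_of_ne hwp
      rw [show p + 1 + n = p + (n + 1) by omega, show q + 1 + n = q + (n + 1) by omega, hp', hq']
      decide
    rwa [hw] at this
  have hw2 : block s (r + 1) n = w := by
    have : block s (r + 1) n ∈ rightSpecial s n := by
      refine mem_rightSpecial_of_ne (k := r' + 1) ?_ ?_
      · have e := hr.trans hr'.symm
        rw [block_succ_left, block_succ_left, List.cons.injEq] at e
        exact e.2
      · rwa [show r + 1 + n = r + (n + 1) by omega, show r' + 1 + n = r' + (n + 1) by omega]
    rwa [hw] at this
  -- The right special word `v` is `aw` with `w` the palindrome. Of `0w0` and `1w1`, choose the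
  -- occurrence `bwb` with `b ≠ a`.
  obtain ⟨z, hz1, hz2, hz3, hz4⟩ : ∃ z, s z ≠ s r ∧ s (z + (n + 1)) ≠ s r ∧
      block s (z + 1) n = w ∧ ∀ k, 1 ≤ k → k < n + 1 → s (z + k) = s (z + (n + 1 - k)) := by
    rcases Fin.exists_fin_two.1 ⟨s r, rfl⟩ with h | h
    · refine ⟨q, by simp [hq, h], by simp [hq', h], hwp ▸ hw1, fun k h1 h2 => ?_⟩
      exact hpal k h1 (by omega)
    · refine ⟨p, by simp [hp, h], by simp [hp', h], hw1, fun k h1 h2 => ?_⟩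
      rw [hmid k h1 (by omega), hpal k h1 (by omega), hmid _ (by omega) (by omega)]
      congr 1
  -- An occurrence of `aw` starting inside `bwb` would, by the palindromicity of `w`, force the
  -- final `b` to equal `a`.
  have hnot : ∀ i ≤ n + 1, block s (z + i) (n + 1) ≠ v := by
    intro i hi h
    have e := block_eq_block_iff.1 (h.trans hr.symm)
    have e0 : s (z + i) = s r := e 0 (by omega)
    rcases Nat.eq_zero_or_pos i with rfl | hi0
    · exact hz1 e0
    rcases Nat.eq_or_lt_of_le hi with rfl | hi1
    · exact hz2 e0
    have e1 := e (n + 1 - i) (by omega)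
    have e2 := block_eq_block_iff.1 (hw2.trans hz3.symm) (n - i) (by omega)
    apply hz2
    rw [← e0, hz4 i hi0 hi1, show z + (n + 1) = z + i + (n + 1 - i) by omega, e1,
      show r + (n + 1 - i) = r + 1 + (n - i) by omega, e2]
    congr 1
    omega
  have hvf : v ∈ factors s (n + 1) := ⟨r, hr⟩
  -- There are `n + 2` positions for the `n + 1` factors other than `v`. Between two equal ones no
  -- right special factor occurs, so the word repeats for ever.
  obtain ⟨i, hi, j, hj, hij, e⟩ : ∃ i ∈ (Finset.range (n + 2) : Set ℕ),
      ∃ j ∈ (Finset.range (n + 2) : Set ℕ), i ≠ j ∧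
        block s (z + i) (n + 1) = block s (z + j) (n + 1) := by
    apply Set.exists_ne_map_eq_of_ncard_lt_of_maps_to (t := factors s (n + 1) \ {v})
      (ht := (factors_finite s _).subset Set.sdiff_subset)
      (f := fun i => block s (z + i) (n + 1))
    · rw [Set.ncard_sdiff_singleton_of_mem hvf, ← complexity_eq, hs]
      simp
    · intro i hi
      exact ⟨⟨z + i, rfl⟩, hnot i (by simp at hi; omega)⟩
  simp only [Finset.coe_range, Set.mem_Iio] at hi hj
  wlog hlt : i < j generalizing i j
  · exact this j i hij.symm e.symm hj hi (by omega)
  refine hs.not_eventuallyPeriodic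
    (eventuallyPeriodic_of_repetition (by omega : z + i < z + j) e fun k hk => ?_)
  have hnv : ∀ l ≤ k, block s (z + i + l) (n + 1) ≠ v := by
    intro l
    induction l using Nat.strong_induction_on with
    | _ l ih =>
      intro hl
      by_cases h : i + l ≤ n + 1
      · rw [add_assoc]
        exact hnot _ h
      · have h1 := ih (i + l - j) (by omega) (by omega)
        rw [hk _ (by omega)] at h1
        convert h1 using 2
        omega
  by_contra hne
  have := mem_rightSpecial_of_ne (hk k le_rfl) hne
  rw [hv] at this
  exact hnv k le_rfl this

/-! ### Counting balanced words; the abelian closure of a Sturmian word. -/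

theorem exists_append_of_ne {A : Type*} {u v : List A} (hl : u.length = v.length) (h : u ≠ v) :
    ∃ x a b r r', u = x ++ a :: r ∧ v = x ++ b :: r' ∧ a ≠ b := by
  induction u generalizing v with
  | nil => exact absurd (List.length_eq_zero_iff.1 hl.symm).symm h
  | cons a u ih =>
    obtain _ | ⟨b, v⟩ := v
    · simp at hl
    by_cases hab : a = b
    · subst hab
      obtain ⟨x, c, d, r, r', rfl, rfl, hcd⟩ := ih (v := v) (by simpa using hl) (by simpa using h)
      exact ⟨a :: x, c, d, r, r', rfl, rfl, hcd⟩
    · exact ⟨[], a, b, u, v, rfl, rfl, hab⟩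

/-- A balanced factorial set of binary words has at most `n + 1` words of length `n`. -/
theorem ncard_le_of_balanced {K : Set (List (Fin 2))}
    (hpre : ∀ u v, u ++ v ∈ K → u ∈ K) (htail : ∀ a u, a :: u ∈ K → u ∈ K)
    (hbal : ∀ u ∈ K, ∀ v ∈ K, u.length = v.length → u.count 1 ≤ v.count 1 + 1) (n : ℕ) :
    {w | w ∈ K ∧ w.length = n}.ncard ≤ n + 1 := by
  have hfin : ∀ (P : List (Fin 2) → Prop) (n : ℕ), {w | P w ∧ w.length = n}.Finite :=
    fun P n => (List.finite_length_eq (Fin 2) n).subset fun w hw => hw.2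
  induction n with
  | zero =>
    refine Set.ncard_le_one (hfin _ 0) |>.2 ?_
    rintro u ⟨-, hu⟩ v ⟨-, hv⟩
    rw [List.length_eq_zero_iff.1 hu, List.length_eq_zero_iff.1 hv]
  | succ n ih =>
    set C : Fin 2 → Set (List (Fin 2)) := fun a => {w | a :: w ∈ K ∧ w.length = n} with hC
    have hsub : {w | w ∈ K ∧ w.length = n + 1} ⊆ List.cons 0 '' C 0 ∪ List.cons 1 '' C 1 := by
      rintro (_ | ⟨a, w⟩) ⟨hw, hl⟩
      · simp at hl
      · have hl' : w.length = n := by simpa using hl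
        rcases Fin.exists_fin_two.1 ⟨a, rfl⟩ with rfl | rfl
        · exact Or.inl ⟨w, ⟨hw, hl'⟩, rfl⟩
        · exact Or.inr ⟨w, ⟨hw, hl'⟩, rfl⟩
    have hunion : C 0 ∪ C 1 ⊆ {w | w ∈ K ∧ w.length = n} := by
      rintro w (⟨h, hl⟩ | ⟨h, hl⟩) <;> exact ⟨htail _ _ h, hl⟩
    have hno : ∀ x, 0 :: (x ++ [0]) ∈ K → 1 :: (x ++ [1]) ∈ K → False := by
      intro x h0 h1
      have := hbal _ h1 _ h0 (by simp)
      simp at this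
    -- Two words extendable to the left by both letters, with longest common prefix `x`, would yield
    -- `0x0` and `1x1`.
    have hinter : (C 0 ∩ C 1).ncard ≤ 1 := by
      refine Set.ncard_le_one ((hfin _ n).subset Set.inter_subset_left) |>.2 ?_
      rintro u ⟨hu0, hu1⟩ v ⟨hv0, hv1⟩
      by_contra hne
      obtain ⟨x, a, b, r, r', rfl, rfl, hab⟩ := exists_append_of_ne (hu0.2.trans hv0.2.symm) hne
      have hp : ∀ c d r, c :: (x ++ d :: r) ∈ K → c :: (x ++ [d]) ∈ K := fun c d r h =>
        hpre _ r (by simpa using h)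
      have hcases : ∀ a b : Fin 2, a ≠ b → (a = 0 ∧ b = 1) ∨ (a = 1 ∧ b = 0) := by decide
      rcases hcases a b hab with ⟨rfl, rfl⟩ | ⟨rfl, rfl⟩
      · exact hno x (hp _ _ _ hu0.1) (hp _ _ _ hv1.1)
      · exact hno x (hp _ _ _ hv0.1) (hp _ _ _ hu1.1)
    have h1 := Set.ncard_le_ncard hsub (((hfin _ n).image _).union ((hfin _ n).image _))
    have h2 := Set.ncard_union_le (List.cons 0 '' C 0) (List.cons 1 '' C 1)
    rw [Set.ncard_image_of_injective _ List.cons_injective,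
      Set.ncard_image_of_injective _ List.cons_injective,
      ← Set.ncard_union_add_ncard_inter (C 0) (C 1) (hfin _ n) (hfin _ n)] at h2
    have h3 := Set.ncard_le_ncard hunion (hfin _ n)
    omega

theorem mem_language_of_append {A : Type*} {x : ℕ → A} {u v : List A} (h : u ++ v ∈ language x) :
    u ∈ language x := by
  obtain ⟨k, n, e⟩ := h
  have hl := congrArg List.length e
  rw [List.length_append, length_block] at hl
  refine ⟨k, u.length, ?_⟩
  have h1 := congrArg (List.take u.length) e
  rw [List.take_left] at h1
  refine h1.trans ?_
  simp only [block, ← List.map_take, List.take_range]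
  congr 2
  omega

theorem mem_language_of_cons {A : Type*} {x : ℕ → A} {a : A} {u : List A}
    (h : a :: u ∈ language x) : u ∈ language x := by
  obtain ⟨k, n, e⟩ := h
  cases n with
  | zero => simp at e
  | succ n =>
    rw [block_succ_left, List.cons.injEq] at e
    exact ⟨_, _, e.2⟩

/-- The abelian closure of a Sturmian word is its orbit closure. -/
theorem IsSturmian.abelianClosure_eq {s : ℕ → Fin 2} (hs : IsSturmian s) :
    abelianClosure s = orbitClosure s := by
  refine Set.Subset.antisymm (fun y hy => ?_) (orbitClosure_subset_abelianClosure s)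
  rw [mem_abelianClosure_iff] at hy
  rw [orbitClosure, Set.mem_ofPred_eq, language_subset_iff]
  intro n
  set K := language s ∪ language y with hK
  -- Every count in `K` is the count of a factor of `s`, so `K` inherits its balance; `s` alone
  -- already supplies `n + 1` words.
  have hle : {w | w ∈ K ∧ w.length = n}.ncard ≤ n + 1 := by
    apply ncard_le_of_balanced
    · rintro u v (h | h)
      · exact Or.inl (mem_language_of_append h)
      · exact Or.inr (mem_language_of_append h)
    · rintro a u (h | h)
      · exact Or.inl (mem_language_of_cons h)
      · exact Or.inr (mem_language_of_cons h)
    · have hcount : ∀ u ∈ K, ∃ k, u.count 1 = (block s k u.length).count 1 := by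
        rintro _ (⟨k, m, rfl⟩ | ⟨k, m, rfl⟩)
        · exact ⟨k, by rw [length_block]⟩
        · obtain ⟨j, hj⟩ := hy k m
          exact ⟨j, by rw [length_block, hj]⟩
      intro u hu v hv huv
      obtain ⟨k, hk⟩ := hcount u hu
      obtain ⟨l, hl⟩ := hcount v hv
      rw [hk, hl, huv]
      exact hs.balanced k l _
  have hsub : factors s n ⊆ {w | w ∈ K ∧ w.length = n} := by
    rintro _ ⟨k, rfl⟩
    exact ⟨Or.inl (block_mem_language s k n), length_block s k n⟩
  have heq := Set.eq_of_subset_of_ncard_le hsub (by rwa [← complexity_eq, hs])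
    ((List.finite_length_eq (Fin 2) n).subset fun w hw => hw.2)
  rw [heq]
  rintro _ ⟨k, rfl⟩
  exact ⟨Or.inr (block_mem_language y k n), length_block y k n⟩

/-- Both closures are compatible with renaming letters. The complexity is carried along for the
alternating case. -/
theorem UpToPerm.abelianClosure_eq {P : (ℕ → Fin 3) → Prop} {u : ℕ → Fin 3}
    (h : UpToPerm P u) (hP : ∀ v, (∀ n, complexity v n = complexity u n) → P v →
      abelianClosure v = orbitClosure v) :
    abelianClosure u = orbitClosure u := by
  obtain ⟨π, hπ⟩ := h
  refine Set.Subset.antisymm (fun y hy => ?_) (orbitClosure_subset_abelianClosure u)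
  have h1 := comp_mem_abelianClosure (f := π) hy
  rw [hP _ (complexity_comp π.injective u) hπ] at h1
  exact (comp_mem_orbitClosure_iff π.injective).1 h1

/-! ### Words `2s` with `s` Sturmian. -/

section TypeOne

theorem count_map_castSucc (a : Fin 2) (w : List (Fin 2)) :
    (w.map Fin.castSucc).count a.castSucc = w.count a :=
  List.count_map_of_injective w _ (Fin.castSucc_injective 2) a

theorem count_two_map_castSucc (w : List (Fin 2)) : (w.map Fin.castSucc).count 2 = 0 := by
  rw [List.count_eq_zero, List.mem_map]
  rintro ⟨a, -, h⟩
  revert a; decide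

theorem exists_castSucc_of_ne_two {a : Fin 3} (h : a ≠ 2) : ∃ b : Fin 2, a = b.castSucc := by
  revert a; decide

theorem castSucc_ne_two (b : Fin 2) : b.castSucc ≠ (2 : Fin 3) := by
  revert b; decide

theorem eq_of_ite_eq {A : Type*} [DecidableEq A] {a b : A}
    (h : ∀ c, (if a = c then 1 else 0) = if b = c then 1 else 0) : a = b := by
  have := h b
  by_contra hne
  simp [hne] at this

/-- The abelian closure of `2s` with `s` Sturmian is its orbit closure. -/
theorem IsTypeOne.abelianClosure_eq {v : ℕ → Fin 3} (hv : IsTypeOne v) :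
    abelianClosure v = orbitClosure v := by
  obtain ⟨s, hs, rfl⟩ := hv
  set v := cons 2 fun n => (s n).castSucc with hv
  refine Set.Subset.antisymm (fun y hy => ?_) (orbitClosure_subset_abelianClosure v)
  rw [mem_abelianClosure_iff] at hy
  have hvs : ∀ i, v (i + 1) = (s i).castSucc := fun i => rfl
  have hblock : ∀ k n, block v (k + 1) n = (block s k n).map Fin.castSucc := by
    intro k n
    rw [← block_comp, ← block_shift]
    rfl
  -- The only `2` of `v` is at position 0, so a block containing `2` can only match a prefix of `v`.
  have hstart : ∀ k n, 2 ∈ block y k n →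
      ∀ a, (block y k n).count a = (block v 0 n).count a := by
    intro k n h
    obtain ⟨j, hj⟩ := hy k n
    rcases Nat.eq_zero_or_pos j with rfl | hpos
    · exact hj
    · exfalso
      have h1 := hj 2
      rw [← Nat.succ_pred_eq_of_pos hpos, Nat.succ_eq_add_one, hblock,
        count_two_map_castSucc] at h1
      exact absurd (List.count_pos_iff.2 h) (by omega)
  have hcount : ∀ k, y k = 2 → ∀ n a,
      (block y (k + 1) n).count a = (block v 1 n).count a := by
    intro k hk n a
    have h := hstart k (n + 1) (by simp [block_succ_left, hk]) a
    rw [count_block_succ_left, count_block_succ_left, hk] at h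
    change _ = (if (2 : Fin 3) = a then 1 else 0) + _ at h
    rw [Nat.zero_add] at h
    omega
  have hnext : ∀ k, y k = 2 → ∀ n, y (k + 1 + n) = v (1 + n) := by
    intro k hk n
    apply eq_of_ite_eq
    intro a
    have h1 := hcount k hk n a
    have h2 := hcount k hk (n + 1) a
    rw [count_block_succ, count_block_succ] at h2
    omega
  have hpos : ∀ k, y (k + 1) ≠ 2 := by
    intro k hk
    -- What follows the `2` has the counts of `v` from position 1 on. Comparing blocks that start
    -- one letter before the `2` with prefixes of `v` leaves `y k` against the last letter of the
    -- prefix, making `s` constant.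
    have hconst : ∀ n, y k = v (1 + n) := by
      intro n
      apply eq_of_ite_eq
      intro a
      have h := hstart k (n + 2) (by simp [block_succ_left, hk]) a
      rw [count_block_succ_left, count_block_succ_left, hk, count_block_succ_left,
        count_block_succ, hcount _ hk] at h
      change _ = (if (2 : Fin 3) = a then 1 else 0) + _ at h
      rw [Nat.zero_add] at h
      omega
    refine hs.not_eventuallyPeriodic ⟨0, 1, one_pos, fun i _ => Fin.castSucc_injective 2 ?_⟩
    rw [← hvs, ← hvs, add_comm (i + 1) 1, add_comm i 1, ← hconst, ← hconst]
  rw [mem_orbitClosure_iff]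
  by_cases h0 : y 0 = 2
  · have : y = v := by
      funext i
      cases i with
      | zero => exact h0
      | succ i =>
        have := hnext 0 h0 i
        rwa [Nat.zero_add, add_comm] at this
    exact fun k n => ⟨k, fun i _ => by rw [this]⟩
  · have hne : ∀ k, y k ≠ 2 := fun k => by
      cases k with
      | zero => exact h0
      | succ k => exact hpos k
    choose t ht using fun k => exists_castSucc_of_ne_two (hne k)
    have hyt : ∀ k n, block y k n = (block t k n).map Fin.castSucc := by
      intro k n
      rw [← block_comp]
      congr 1
      funext i
      exact ht i
    have htA : t ∈ abelianClosure s := by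
      rw [mem_abelianClosure_iff]
      intro k n
      rcases Nat.eq_zero_or_pos n with rfl | hn
      · exact ⟨0, fun a => rfl⟩
      obtain ⟨j, hj⟩ := hy k n
      rcases Nat.eq_zero_or_pos j with rfl | hj0
      · exfalso
        have h1 := hj 2
        rw [hyt, count_two_map_castSucc, ← Nat.succ_pred_eq_of_pos hn, Nat.succ_eq_add_one,
          count_block_succ_left] at h1
        change 0 = 1 + _ at h1
        omega
      · refine ⟨j - 1, fun a => ?_⟩
        have h1 := hj a.castSucc
        rwa [hyt, count_map_castSucc, ← Nat.succ_pred_eq_of_pos hj0, Nat.succ_eq_add_one, hblock,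
          count_map_castSucc] at h1
    rw [hs.abelianClosure_eq, mem_orbitClosure_iff] at htA
    intro k n
    obtain ⟨j, hj⟩ := htA k n
    refine ⟨j + 1, fun i hi => ?_⟩
    rw [ht, hj i hi, add_right_comm, hvs]

end TypeOne

/-! ### Local rules for morphic images. -/

section MorphicImage

theorem morphicImage_rel {A B : Type*} {φ : A → List B} (hφ : ∀ a, φ a ≠ []) {R : B → B → Prop}
    (h : ∀ l : List A, (l.flatMap φ).IsChain R) (x : ℕ → A) (n : ℕ) :
    R (morphicImage φ hφ x n) (morphicImage φ hφ x (n + 1)) := by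
  have hlen : n + 2 ≤ ((block x 0 (n + 2)).flatMap φ).length := by
    have := le_length_flatMap φ hφ (block x 0 (n + 2))
    rwa [length_block] at this
  have hlen' : n + 1 ≤ ((block x 0 (n + 1)).flatMap φ).length := by
    have := le_length_flatMap φ hφ (block x 0 (n + 1))
    rwa [length_block] at this
  have h1 : morphicImage φ hφ x n = ((block x 0 (n + 2)).flatMap φ)[n]'(by omega) := by
    simp only [block_succ x 0 (n + 1), List.flatMap_append]
    rw [List.getElem_append_left (by omega)]
    rfl
  rw [h1]
  exact List.isChain_iff_getElem.1 (h (block x 0 (n + 2))) n (by omega)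

theorem rel_of_mem_orbitClosure {A : Type*} {R : A → A → Prop} {x y : ℕ → A}
    (hx : ∀ n, R (x n) (x (n + 1))) (hy : y ∈ orbitClosure x) (n : ℕ) : R (y n) (y (n + 1)) := by
  obtain ⟨j, hj⟩ := mem_orbitClosure_iff.1 hy n 2
  have h0 := hj 0 (by omega)
  have h1 := hj 1 (by omega)
  rw [Nat.add_zero, Nat.add_zero] at h0
  rw [h0, h1]
  exact hx j

theorem isChain_flatMap_morphA (l : List (Fin 2)) :
    (l.flatMap morphA).IsChain fun a b => a = 2 ↔ b ≠ 2 := by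
  induction l with
  | nil => simp
  | cons a l ih =>
    rw [List.flatMap_cons, List.isChain_append]
    refine ⟨?_, ih, ?_⟩
    · fin_cases a <;> simp [morphA]
    · cases l with
      | nil => simp
      | cons b l => fin_cases a <;> fin_cases b <;> simp [morphA]

theorem isChain_flatMap_morphB (l : List (Fin 2)) :
    (l.flatMap morphB).IsChain fun a b => a = 1 ↔ b = 2 := by
  induction l with
  | nil => simp
  | cons a l ih =>
    rw [List.flatMap_cons, List.isChain_append]
    refine ⟨?_, ih, ?_⟩
    · fin_cases a <;> simp [morphB]
    · cases l with
      | nil => simp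
      | cons b l => fin_cases a <;> fin_cases b <;> simp [morphB]

end MorphicImage

/-! ### Words in which every other letter is `2`. -/

section TypeTwo

/-- `v` alternates between the letter `2` and the letters of the binary word `t`, whose first
letter is at position `e ≤ 1`. -/
structure IsInterleaving (v : ℕ → Fin 3) (e : ℕ) (t : ℕ → Fin 2) : Prop where
  le : e ≤ 1
  even : ∀ i, v (e + 2 * i) = (t i).castSucc
  odd : ∀ i, v (e + 2 * i + 1) = 2
  zero : e = 1 → v 0 = 2

theorem exists_isInterleaving {v : ℕ → Fin 3} (h : ∀ i, v i = 2 ↔ v (i + 1) ≠ 2) :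
    ∃ e t, IsInterleaving v e t := by
  obtain ⟨e, he, h0, hz⟩ : ∃ e ≤ 1, v e ≠ 2 ∧ (e = 1 → v 0 = 2) := by
    by_cases h0 : v 0 = 2
    · exact ⟨1, le_rfl, (h 0).1 h0, fun _ => h0⟩
    · exact ⟨0, by omega, h0, by omega⟩
  have hne : ∀ i, v (e + 2 * i) ≠ 2 := by
    intro i
    induction i with
    | zero => exact h0
    | succ i ih =>
      have h1 : v (e + 2 * i + 1) = 2 := by
        by_contra hcon
        exact ih ((h _).2 hcon)
      exact (h _).1 h1
  choose t ht using fun i => exists_castSucc_of_ne_two (hne i)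
  refine ⟨e, t, he, ht, fun i => ?_, hz⟩
  by_contra hcon
  exact hne i ((h _).2 hcon)

namespace IsInterleaving

variable {v y : ℕ → Fin 3} {e e' : ℕ} {t r : ℕ → Fin 2}

theorem exists_eq_of_ne_two (h : IsInterleaving v e t) {j : ℕ} (hj : v j ≠ 2) :
    ∃ m, j = e + 2 * m := by
  have hle := h.le
  rcases Nat.lt_or_ge j e with hlt | hge
  · obtain rfl : j = 0 := by omega
    exact absurd (h.zero (by omega)) hj
  rcases Nat.even_or_odd' (j - e) with ⟨m, hm | hm⟩
  · exact ⟨m, by omega⟩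
  · refine absurd (h.odd m) ?_
    rwa [show e + 2 * m + 1 = j by omega]

theorem eq_of_eq (hy : IsInterleaving y e' r) (hv : IsInterleaving v e t) {m j n : ℕ}
    (h : ∀ i < n, r (m + i) = t (j + i)) :
    ∀ i < n, y (e' + 2 * m + i) = v (e + 2 * j + i) := by
  intro i hi
  rcases Nat.even_or_odd' i with ⟨l, hl | hl⟩
  · have h1 := hy.even (m + l)
    have h2 := hv.even (j + l)
    rw [h l (by omega)] at h1
    rw [hl, add_assoc, add_assoc, ← mul_add, ← mul_add, h1, h2]
  · have h1 := hy.odd (m + l)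
    have h2 := hv.odd (j + l)
    rw [show e' + 2 * m + i = e' + 2 * (m + l) + 1 by omega,
      show e + 2 * j + i = e + 2 * (j + l) + 1 by omega, h1, h2]

theorem eventuallyPeriodic (h : IsInterleaving v e t) (ht : EventuallyPeriodic t) :
    EventuallyPeriodic v := by
  obtain ⟨N, p, hp, ht⟩ := ht
  refine ⟨e + 2 * N, 2 * p, by omega, fun i hi => ?_⟩
  have := h.eq_of_eq h (m := N + p) (j := N) (n := i + 1 - (e + 2 * N))
    (fun l _ => by rw [add_right_comm, ht _ (by omega)]) (i - (e + 2 * N)) (by omega)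
  convert this using 2 <;> omega

theorem count_block (h : IsInterleaving v e t) (a : Fin 2) (m n : ℕ) :
    (block v (e + 2 * m) (2 * n)).count a.castSucc = (block t m n).count a := by
  induction n with
  | zero => rfl
  | succ n ih =>
    rw [show 2 * (n + 1) = 2 * n + 1 + 1 by ring, count_block_succ, count_block_succ, ih,
      count_block_succ, ← add_assoc, show e + 2 * m + 2 * n = e + 2 * (m + n) by ring, h.even, h.odd,
      if_neg (castSucc_ne_two a).symm, Nat.add_zero]
    simp

/-- A window of even length starting on a `2` can slide one place to the right: it loses a `2` and
gains a `2`. -/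
theorem exists_count_block (h : IsInterleaving v e t) (j n : ℕ) :
    ∃ m, ∀ a : Fin 2, (block v j (2 * n)).count a.castSucc = (block t m n).count a := by
  by_cases hj : v j = 2
  · have hj' : v (j + 1) ≠ 2 ∧ v (j + 2 * n) = 2 := by
      have hle := h.le
      rcases Nat.lt_or_ge j e with hlt | hge
      · obtain ⟨rfl, rfl⟩ : j = 0 ∧ e = 1 := by omega
        refine ⟨(h.even 0).trans_ne (castSucc_ne_two _), ?_⟩
        cases n with
        | zero => exact hj
        | succ n =>
          have := h.odd n
          rwa [show 0 + 2 * (n + 1) = 1 + 2 * n + 1 by omega]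
      · rcases Nat.even_or_odd' (j - e) with ⟨m, hm | hm⟩
        · refine absurd hj ?_
          rw [show j = e + 2 * m by omega, h.even]
          exact castSucc_ne_two _
        · refine ⟨?_, ?_⟩
          · rw [show j + 1 = e + 2 * (m + 1) by omega, h.even]
            exact castSucc_ne_two _
          · rw [show j + 2 * n = e + 2 * (m + n) + 1 by omega, h.odd]
    obtain ⟨m, hm⟩ := h.exists_eq_of_ne_two hj'.1
    refine ⟨m, fun a => ?_⟩
    rw [← h.count_block, ← hm]
    have h1 := count_block_succ a.castSucc v j (2 * n)
    have h2 := count_block_succ_left a.castSucc v j (2 * n)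
    rw [hj'.2, if_neg (castSucc_ne_two a).symm] at h1
    rw [hj, if_neg (castSucc_ne_two a).symm] at h2
    omega
  · obtain ⟨m, rfl⟩ := h.exists_eq_of_ne_two hj
    exact ⟨m, fun a => h.count_block a m n⟩

/-- The letters other than `2` of a ternary word. -/
def eraseTwo (w : List (Fin 3)) : List (Fin 2) :=
  w.filterMap ![some 0, some 1, none]

theorem eraseTwo_block (h : IsInterleaving v e t) (m n : ℕ) :
    eraseTwo (block v (e + 2 * m) (2 * n)) = block t m n := by
  induction n with
  | zero => rfl
  | succ n ih =>
    rw [show 2 * (n + 1) = 2 * n + 1 + 1 by ring, block_succ, block_succ, block_succ, ← ih,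
      ← add_assoc, show e + 2 * m + 2 * n = e + 2 * (m + n) by ring, h.even, h.odd]
    rcases Fin.exists_fin_two.1 ⟨t (m + n), rfl⟩ with h0 | h0 <;> rw [h0] <;>
      simp [eraseTwo]

/-- A factor of odd length starts either with a letter of `t` or with `2`. The two kinds are
disjoint and, once the `2`s are erased, yield the factors of `t` of length `n + 1` and of `shift t`
of length `n`. -/
theorem complexity_add_le (h : IsInterleaving v e t) (n : ℕ) :
    complexity t (n + 1) + complexity (shift t) n ≤ complexity v (2 * n + 1) := by
  set P : Set (List (Fin 3)) := Set.range fun i => block v (e + 2 * i) (2 * n + 1) with hP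
  set Q : Set (List (Fin 3)) := Set.range fun i => block v (e + 2 * i + 1) (2 * n + 1) with hQ
  have hPv : P ⊆ factors v (2 * n + 1) := by
    rintro _ ⟨i, rfl⟩
    exact ⟨_, rfl⟩
  have hQv : Q ⊆ factors v (2 * n + 1) := by
    rintro _ ⟨i, rfl⟩
    exact ⟨_, rfl⟩
  have hfin := factors_finite v (2 * n + 1)
  have hdisj : Disjoint P Q := by
    rw [Set.disjoint_left]
    rintro _ ⟨i, rfl⟩ ⟨j, hj⟩
    have := block_eq_block_iff.1 hj 0 (by omega)
    simp only [Nat.add_zero] at this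
    rw [h.odd, h.even] at this
    exact castSucc_ne_two _ this.symm
  have h1 : factors t (n + 1) ⊆ eraseTwo '' P := by
    rintro _ ⟨i, rfl⟩
    refine ⟨_, ⟨i, rfl⟩, ?_⟩
    simp only
    rw [← h.eraseTwo_block i (n + 1), show 2 * (n + 1) = 2 * n + 1 + 1 by ring,
      block_succ v _ (2 * n + 1), ← add_assoc, add_assoc e, ← mul_add, h.odd]
    simp [eraseTwo]
  have h2 : factors (shift t) n ⊆ eraseTwo '' Q := by
    rintro _ ⟨i, rfl⟩
    refine ⟨_, ⟨i, rfl⟩, ?_⟩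
    simp only
    rw [block_shift, ← h.eraseTwo_block (i + 1) n, block_succ_left, h.odd,
      show e + 2 * i + 1 + 1 = e + 2 * (i + 1) by ring]
    exact List.filterMap_cons_none rfl
  have h3 := (Set.ncard_le_ncard h1 ((hfin.subset hPv).image _)).trans
    (Set.ncard_image_le (hfin.subset hPv))
  have h4 := (Set.ncard_le_ncard h2 ((hfin.subset hQv).image _)).trans
    (Set.ncard_image_le (hfin.subset hQv))
  have h5 := Set.ncard_le_ncard (Set.union_subset hPv hQv) hfin
  rw [Set.ncard_union_eq hdisj (hfin.subset hPv) (hfin.subset hQv)] at h5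
  rw [complexity_eq, complexity_eq, complexity_eq]
  omega

theorem isSturmian (h : IsInterleaving v e t) (hv : ∀ n, 1 ≤ n → complexity v n = n + 2) :
    IsSturmian t := by
  have ht : ¬ EventuallyPeriodic t := fun ht =>
    not_eventuallyPeriodic_of_le_complexity (fun n hn => by rw [hv n hn]; omega)
      (h.eventuallyPeriodic ht)
  refine isSturmian_of_complexity_le ht fun n hn => ?_
  have h1 := h.complexity_add_le (n - 1)
  have h2 := succ_le_complexity (fun h => ht h.of_shift) (n - 1)
  rw [hv _ (by omega), Nat.sub_add_cancel (by omega)] at h1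
  omega

theorem mem_abelianClosure (hy : IsInterleaving y e' r) (hv : IsInterleaving v e t)
    (h : y ∈ abelianClosure v) : r ∈ abelianClosure t := by
  rw [mem_abelianClosure_iff] at h ⊢
  intro k n
  obtain ⟨j, hj⟩ := h (e' + 2 * k) (2 * n)
  obtain ⟨m, hm⟩ := hv.exists_count_block j n
  exact ⟨m, fun a => by rw [← hm, ← hj, hy.count_block]⟩

end IsInterleaving

theorem count_two_block_two (v : ℕ → Fin 3) (i : ℕ) :
    (block v i 2).count 2 = (if v i = 2 then 1 else 0) + if v (i + 1) = 2 then 1 else 0 := by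
  rw [count_block_succ, count_block_succ]
  simp

/-- The abelian closure of a word of complexity `n + 2` in which every other letter is `2` is its
orbit closure. -/
theorem abelianClosure_eq_of_alternating {v : ℕ → Fin 3} (h : ∀ i, v i = 2 ↔ v (i + 1) ≠ 2)
    (hv : ∀ n, 1 ≤ n → complexity v n = n + 2) : abelianClosure v = orbitClosure v := by
  refine Set.Subset.antisymm (fun y hy => ?_) (orbitClosure_subset_abelianClosure v)
  have hy2 : ∀ i, y i = 2 ↔ y (i + 1) ≠ 2 := by
    intro i
    obtain ⟨j, hj⟩ := mem_abelianClosure_iff.1 hy i 2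
    have h1 := hj 2
    have h2 := h j
    rw [count_two_block_two, count_two_block_two] at h1
    split_ifs at h1 <;> omega
  obtain ⟨e, t, hvt⟩ := exists_isInterleaving h
  obtain ⟨e', r, hyr⟩ := exists_isInterleaving hy2
  have ht := hvt.isSturmian hv
  have hr : r ∈ orbitClosure t := by
    rw [← ht.abelianClosure_eq]
    exact hyr.mem_abelianClosure hvt hy
  rw [mem_orbitClosure_iff] at hr ⊢
  intro k n
  by_cases hk : y k = 2
  · obtain ⟨m, hm⟩ := hyr.exists_eq_of_ne_two ((hy2 k).1 hk)
    obtain ⟨j, hj⟩ := hr m n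
    -- The leading `2` needs room: at a positive position of `t`, a `2` precedes the matching
    -- letters in `v`.
    have hmem : block r m n ∈ factors (shift t) n := by
      rw [ht.factors_shift]
      exact ⟨j, (block_eq_block_iff.2 hj).symm⟩
    obtain ⟨l, hl⟩ := hmem
    simp only [block_shift] at hl
    have hl' := hyr.eq_of_eq hvt (block_eq_block_iff.1 hl.symm)
    refine ⟨e + 2 * l + 1, fun i hi => ?_⟩
    cases i with
    | zero => rw [Nat.add_zero, Nat.add_zero, hk, hvt.odd]
    | succ i =>
      have := hl' i (by omega)
      rw [← hm] at this
      convert this using 2 <;> omega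
  · obtain ⟨m, rfl⟩ := hyr.exists_eq_of_ne_two hk
    obtain ⟨j, hj⟩ := hr m n
    exact ⟨_, hyr.eq_of_eq hvt hj⟩

theorem IsTypeTwo.abelianClosure_eq {v : ℕ → Fin 3} (h : IsTypeTwo v)
    (hv : ∀ n, 1 ≤ n → complexity v n = n + 2) : abelianClosure v = orbitClosure v := by
  obtain ⟨s, -, hs⟩ := h
  exact abelianClosure_eq_of_alternating
    (rel_of_mem_orbitClosure
    (R := fun a b => a = 2 ↔ b ≠ 2) (morphicImage_rel morphA_ne_nil isChain_flatMap_morphA s) hs) hv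

end TypeTwo

/-! ### Slope of a Sturmian word and counts in consecutive windows. -/

section Slope

theorem eventuallyPeriodic_of_count_eq {s : ℕ → Fin 2} {n N c : ℕ} (hn : 1 ≤ n)
    (h : ∀ p ≥ N, (block s p n).count 1 = c) : EventuallyPeriodic s := by
  refine ⟨N, n, hn, fun i hi => ?_⟩
  have h1 := count_block_succ 1 s i n
  rw [count_block_succ_left, h i hi, h (i + 1) (by omega)] at h1
  rw [fin_two_eq_iff]
  split_ifs at h1 <;> simp_all

/-- For a Sturmian word, exactly two consecutive numbers of ones occur in the factors of a given
length, and both occur infinitely often. -/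
theorem IsSturmian.exists_count {s : ℕ → Fin 2} (hs : IsSturmian s) {n : ℕ} (hn : 1 ≤ n) :
    ∃ f : ℕ, (∀ p, (block s p n).count 1 = f ∨ (block s p n).count 1 = f + 1) ∧
      (∀ N, ∃ p ≥ N, (block s p n).count 1 = f) ∧
      ∀ N, ∃ p ≥ N, (block s p n).count 1 = f + 1 := by
  classical
  have hex : ∃ f p, (block s p n).count 1 = f := ⟨_, 0, rfl⟩
  obtain ⟨p₀, hp₀⟩ := Nat.find_spec hex
  have hcases : ∀ p, (block s p n).count 1 = Nat.find hex ∨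
      (block s p n).count 1 = Nat.find hex + 1 := by
    intro p
    have h1 := Nat.find_min' hex ⟨p, rfl⟩
    have h2 := hs.balanced p p₀ n
    omega
  refine ⟨Nat.find hex, hcases, fun N => ?_, fun N => ?_⟩
  · by_contra! hcon
    exact hs.not_eventuallyPeriodic (eventuallyPeriodic_of_count_eq (N := N) hn fun p hp =>
      (hcases p).resolve_left (hcon p hp))
  · by_contra! hcon
    exact hs.not_eventuallyPeriodic (eventuallyPeriodic_of_count_eq (N := N) hn fun p hp =>
      (hcases p).resolve_right (hcon p hp))

theorem le_count_block_mul {s : ℕ → Fin 2} {n a : ℕ} (h : ∀ p, a ≤ (block s p n).count 1)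
    (m p : ℕ) : m * a ≤ (block s p (m * n)).count 1 := by
  induction m with
  | zero => simp
  | succ m ih =>
    rw [Nat.succ_mul, Nat.succ_mul, count_block_add]
    exact add_le_add ih (h _)

theorem count_block_mul_le {s : ℕ → Fin 2} {n a : ℕ} (h : ∀ p, (block s p n).count 1 ≤ a)
    (m p : ℕ) : (block s p (m * n)).count 1 ≤ m * a := by
  induction m with
  | zero => simp
  | succ m ih =>
    rw [Nat.succ_mul, Nat.succ_mul, count_block_add]
    exact add_le_add ih (h _)

/-- The two positions are congruent modulo `n`, so the stretch between the blocks is cut into blocks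
of length `n`. -/
theorem exists_two_count_eq {s : ℕ → Fin 2} {n c : ℕ} (hn : 1 ≤ n)
    (h : ∀ N, ∃ p ≥ N, (block s p n).count 1 = c) :
    ∃ p k, (block s p n).count 1 = c ∧ (block s (p + (n + k * n)) n).count 1 = c := by
  have hinf : {p | (block s p n).count 1 = c}.Infinite :=
    Set.infinite_of_forall_exists_gt fun N => by
      obtain ⟨p, hp, e⟩ := h (N + 1)
      exact ⟨p, e, hp⟩
  obtain ⟨p, hp, q, hq, hne, e⟩ := hinf.exists_ne_map_eq_of_mapsTo (f := fun p => p % n)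
    (t := Set.Iio n) (fun p _ => Nat.mod_lt p hn) (Set.finite_Iio n)
  wlog hlt : p < q generalizing p q
  · exact this q hq p hp hne.symm e.symm (by omega)
  obtain ⟨d, hd⟩ := (Nat.modEq_iff_dvd' hlt.le).1 e
  obtain _ | d := d
  · rw [Nat.mul_zero] at hd
    omega
  refine ⟨p, d, hp, ?_⟩
  rw [show p + (n + d * n) = q by rw [mul_comm d n]; rw [Nat.mul_succ] at hd; omega]
  exact hq

/-- A Sturmian word has an irrational slope `γ`, and a factor of length `n` has either `⌊nγ⌋` or
`⌊nγ⌋ + 1` ones. -/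
theorem IsSturmian.exists_slope {s : ℕ → Fin 2} (hs : IsSturmian s) :
    ∃ γ : ℝ, Irrational γ ∧ ∀ n : ℕ, 1 ≤ n → ∃ f : ℕ, (f : ℝ) < n * γ ∧ n * γ < f + 1 ∧
      (∀ p, (block s p n).count 1 = f ∨ (block s p n).count 1 = f + 1) ∧
      (∀ N, ∃ p ≥ N, (block s p n).count 1 = f) ∧
      ∀ N, ∃ p ≥ N, (block s p n).count 1 = f + 1 := by
  choose! f hf hlight hheavy using fun n (hn : 1 ≤ n) => hs.exists_count hn
  have hlo : ∀ n, 1 ≤ n → ∀ p, f n ≤ (block s p n).count 1 := fun n hn p => by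
    have := hf n hn p
    omega
  have hup : ∀ n, 1 ≤ n → ∀ p, (block s p n).count 1 ≤ f n + 1 := fun n hn p => by
    have := hf n hn p
    omega
  -- The prefix of length `m * n` is cut into blocks of length `m` for the lower bound and of length
  -- `n` for the upper bound.
  have hcross : ∀ m n, 1 ≤ m → 1 ≤ n → (f m : ℝ) / m ≤ (f n + 1) / n := by
    intro m n hm hn
    have h1 := le_count_block_mul (hlo m hm) n 0
    have h2 := count_block_mul_le (hup n hn) m 0
    rw [mul_comm] at h2
    have h3 : (n * f m : ℝ) ≤ m * (f n + 1) := by exact_mod_cast h1.trans h2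
    have hm' : (0 : ℝ) < m := by exact_mod_cast hm
    have hn' : (0 : ℝ) < n := by exact_mod_cast hn
    rw [div_le_div_iff₀ hm' hn']
    linarith
  set γ : ℝ := ⨆ n : ℕ, (f (n + 1) : ℝ) / (n + 1 : ℕ) with hγ
  have hbdd : BddAbove (Set.range fun n : ℕ => (f (n + 1) : ℝ) / (n + 1 : ℕ)) :=
    ⟨_, by rintro _ ⟨n, rfl⟩; exact hcross (n + 1) 1 (by omega) le_rfl⟩
  have hle : ∀ n : ℕ, 1 ≤ n → (f n : ℝ) ≤ n * γ := by
    intro n hn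
    have h1 := le_ciSup hbdd (n - 1)
    have hn' : (0 : ℝ) < n := by exact_mod_cast hn
    simp only [Nat.sub_add_cancel hn] at h1
    rw [div_le_iff₀ hn'] at h1
    linarith
  have hge : ∀ n : ℕ, 1 ≤ n → n * γ ≤ f n + 1 := by
    intro n hn
    have hn' : (0 : ℝ) < n := by exact_mod_cast hn
    have h1 : γ ≤ (f n + 1) / n := ciSup_le fun m => hcross (m + 1) n (by omega) hn
    rw [le_div_iff₀ hn'] at h1
    linarith
  have hlen : ∀ n k, n + k * n + n = (k + 2) * n := fun n k => by ring
  have hsplit : ∀ p n k, (block s p ((k + 2) * n)).count 1 = (block s p n).count 1 +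
      (block s (p + n) (k * n)).count 1 + (block s (p + (n + k * n)) n).count 1 := by
    intro p n k
    rw [← hlen, count_block_add, count_block_add]
  -- If `n * γ = f n`, two heavy blocks at the ends of a block of length `(k + 2) * n` give it at
  -- least `(k + 2) * f n + 2` ones, one more than its slope allows. The strict upper bound uses two
  -- light blocks.
  have hlt : ∀ n : ℕ, 1 ≤ n → (f n : ℝ) < n * γ := by
    intro n hn
    refine lt_of_le_of_ne (hle n hn) fun heq => ?_
    obtain ⟨p, k, h1, h2⟩ := exists_two_count_eq hn (hheavy n hn)
    have h3 := hsplit p n k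
    have h4 := le_count_block_mul (hlo n hn) k (p + n)
    have hM : 1 ≤ (k + 2) * n := Nat.mul_pos (by omega) hn
    have h5 := hup _ hM p
    have h6 := hle _ hM
    push_cast at h6
    rw [mul_assoc, ← heq] at h6
    have h7 : f ((k + 2) * n) ≤ (k + 2) * f n := by exact_mod_cast h6
    have h8 := add_mul k 2 (f n)
    omega
  have hgt : ∀ n : ℕ, 1 ≤ n → n * γ < f n + 1 := by
    intro n hn
    refine lt_of_le_of_ne (hge n hn) fun heq => ?_
    obtain ⟨p, k, h1, h2⟩ := exists_two_count_eq hn (hlight n hn)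
    have h3 := hsplit p n k
    have h4 := count_block_mul_le (hup n hn) k (p + n)
    have hM : 1 ≤ (k + 2) * n := Nat.mul_pos (by omega) hn
    have h5 := hlo _ hM p
    have h6 := hge _ hM
    push_cast at h6
    rw [mul_assoc, heq] at h6
    have h7 : (k + 2) * (f n + 1) ≤ f ((k + 2) * n) + 1 := by exact_mod_cast h6
    have h8 := add_mul k 2 (f n + 1)
    omega
  refine ⟨γ, ?_, fun n hn => ⟨f n, hlt n hn, hgt n hn, hf n hn, hlight n hn, hheavy n hn⟩⟩
  rintro ⟨q, hq⟩
  have hden : (q.den : ℝ) * γ = q.num := by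
    rw [← hq]
    exact_mod_cast Rat.den_mul_eq_num q
  have h1 := hlt q.den q.pos
  have h2 := hgt q.den q.pos
  rw [hden] at h1 h2
  have h1' : (f q.den : ℤ) < q.num := by exact_mod_cast h1
  have h2' : q.num < (f q.den : ℤ) + 1 := by exact_mod_cast h2
  omega

theorem exists_step {a : ℕ → ℕ} {f g : ℕ} (hne : f ≠ g) (h : ∀ p, a p = f ∨ a p = g)
    (hf : ∀ N, ∃ p ≥ N, a p = f) (hg : ∀ N, ∃ p ≥ N, a p = g) :
    ∃ p, a p = f ∧ a (p + 1) = g := by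
  by_contra! hcon
  obtain ⟨p, -, hp⟩ := hf 0
  obtain ⟨q, hq, hq'⟩ := hg p
  have : ∀ q ≥ p, a q = f := fun q hq => by
    induction q, hq using Nat.le_induction with
    | base => exact hp
    | succ q _ ih => exact (h (q + 1)).resolve_right (hcon q ih)
  exact hne ((this q hq).symm.trans hq')

/-- If `γ` is the slope of `s`, then factors of length `n` at consecutive positions can have
any admissible pair of numbers of ones, with the two restrictions dictated by `γ`. -/
theorem exists_consecutive_counts {s : ℕ → Fin 2} {γ : ℝ} (hγ : ∀ n : ℕ, 1 ≤ n → ∃ f : ℕ,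
      (f : ℝ) < n * γ ∧ n * γ < f + 1 ∧
      (∀ p, (block s p n).count 1 = f ∨ (block s p n).count 1 = f + 1) ∧
      (∀ N, ∃ p ≥ N, (block s p n).count 1 = f) ∧
      ∀ N, ∃ p ≥ N, (block s p n).count 1 = f + 1) {n f l m : ℕ} (hn : 1 ≤ n)
    (hf : (f : ℝ) < n * γ) (hf' : n * γ < f + 1) (hl : l = f ∨ l = f + 1) (hm : m = f ∨ m = f + 1)
    (hheavy : l = f + 1 → m = f + 1 → f + γ < n * γ)
    (hlight : l = f → m = f → n * γ + γ < f + 1) :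
    ∃ p, (block s p n).count 1 = m ∧ (block s (p + 1) n).count 1 = l := by
  obtain ⟨f', h1, h2, hcases, hinf, hinf'⟩ := hγ n hn
  obtain rfl : f = f' := by
    have h3 : (f : ℝ) < f' + 1 := hf.trans h2
    have h4 : (f' : ℝ) < f + 1 := h1.trans hf'
    norm_cast at h3 h4
    omega
  rcases hl with rfl | rfl <;> rcases hm with rfl | rfl
  -- If no two consecutive windows are light, every block of length `n + 1` has at least `f + 1`
  -- ones, against `(n + 1) * γ < f + 1`.
  · by_contra! hcon
    obtain ⟨g, g1, -, -, g2, -⟩ := hγ (n + 1) (by omega)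
    obtain ⟨p, -, hp⟩ := g2 0
    have hge : m + 1 ≤ g := by
      have e1 := count_block_succ 1 s p n
      have e2 := count_block_succ_left 1 s p n
      have e3 := hcases p
      have e4 := hcases (p + 1)
      have e5 := hcon p
      by_contra hlt
      split_ifs at e1 e2 <;> omega
    have h3 := hlight rfl rfl
    have h4 : ((m : ℝ) + 1) ≤ g := by exact_mod_cast hge
    push_cast at g1
    linarith
  · exact exists_step (by omega) (fun p => (hcases p).symm) hinf' hinf
  · exact exists_step (by omega) hcases hinf hinf'
  -- Here the overlap of the two windows is what counts: a heavy overlap with `f` or more ones would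
  -- make both windows heavy. The occurrence is taken at a position `≥ 1` because the first window
  -- starts one place before the overlap.
  · have h3 := hheavy rfl rfl
    by_contra! hcon
    obtain _ | _ | n := n
    · omega
    · have h4 : (0 : ℝ) ≤ f := Nat.cast_nonneg f
      push_cast at h3
      linarith
    obtain ⟨g, -, g1, -, -, g2⟩ := hγ (n + 1) (by omega)
    obtain ⟨p, hp1, hp⟩ := g2 1
    obtain ⟨p, rfl⟩ : ∃ q, p = q + 1 := ⟨p - 1, by omega⟩
    have hge : g + 1 ≤ f := by
      have e1 := count_block_succ 1 s (p + 1) (n + 1)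
      have e2 := count_block_succ_left 1 s p (n + 1)
      have e3 := hcases p
      have e4 := hcases (p + 1)
      have e5 := hcon p
      by_contra hlt
      split_ifs at e1 e2 <;> omega
    have h4 : ((g : ℝ) + 1) ≤ f := by exact_mod_cast hge
    push_cast at g1 h3
    linarith

end Slope

/-! ### The binary word of the `1`s when the `2`s are their successors. -/

section Marking

variable {v : ℕ → Fin 3}

/-- The binary word marking the occurrences of the letter `1`. -/
def markOne (v : ℕ → Fin 3) (i : ℕ) : Fin 2 := if v i = 1 then 1 else 0

theorem markOne_eq_one_iff (i : ℕ) : markOne v i = 1 ↔ v i = 1 := by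
  simp [markOne]

theorem fin_three_eq_iff {a b : Fin 3} : a = b ↔ (a = 1 ↔ b = 1) ∧ (a = 2 ↔ b = 2) := by
  revert a b; decide

theorem EventuallyPeriodic.of_markOne (h : ∀ i, v i = 1 ↔ v (i + 1) = 2)
    (ht : EventuallyPeriodic (markOne v)) : EventuallyPeriodic v := by
  obtain ⟨N, p, hp, ht⟩ := ht
  refine ⟨N + 1, p, hp, fun i hi => ?_⟩
  obtain ⟨i, rfl⟩ : ∃ j, i = j + 1 := ⟨i - 1, by omega⟩
  rw [fin_three_eq_iff, ← markOne_eq_one_iff, ← markOne_eq_one_iff, ht _ (by omega),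
    add_right_comm, ← h, ← h, ← markOne_eq_one_iff, ← markOne_eq_one_iff, ht _ (by omega)]
  exact ⟨Iff.rfl, Iff.rfl⟩

/-- A factor of `v` also reveals the mark just before it: that mark is 1 exactly when the factor
begins with `2`. This gains one unit of length. -/
theorem complexity_markOne_le (h : ∀ i, v i = 1 ↔ v (i + 1) = 2) (n : ℕ) :
    complexity (markOne v) (n + 2) ≤ complexity v (n + 1) := by
  set g : List (Fin 3) → List (Fin 2) := fun w =>
    (if w.head? = some 2 then 1 else 0) :: w.map fun a => if a = 1 then 1 else 0 with hg
  have hsub : factors (markOne v) (n + 2) ⊆ g '' factors v (n + 1) := by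
    rintro _ ⟨i, rfl⟩
    refine ⟨_, ⟨i + 1, rfl⟩, ?_⟩
    simp only [hg]
    rw [block_succ_left (markOne v), ← block_comp]
    congr 1
    rw [block_succ_left, markOne]
    simp only [List.head?_cons, Option.some_inj, h]
  rw [complexity_eq, complexity_eq]
  exact (Set.ncard_le_ncard hsub ((factors_finite v _).image _)).trans
    (Set.ncard_image_le (factors_finite v _))

theorem isSturmian_markOne (h : ∀ i, v i = 1 ↔ v (i + 1) = 2)
    (hv : ∀ n, 1 ≤ n → complexity v n = n + 2) : IsSturmian (markOne v) := by
  refine isSturmian_of_complexity_le (fun ht => ?_) fun n hn => ?_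
  · exact not_eventuallyPeriodic_of_le_complexity (fun n hn => by rw [hv n hn]; omega)
      (ht.of_markOne h)
  · obtain ⟨n, rfl⟩ : ∃ m, n = m + 2 := ⟨n - 2, by omega⟩
    exact (complexity_markOne_le h n).trans (hv (n + 1) (by omega)).le

theorem count_one_block_markOne (k n : ℕ) :
    (block v k n).count 1 = (block (markOne v) k n).count 1 := by
  induction n with
  | zero => rfl
  | succ n ih => simp only [count_block_succ, ih, markOne_eq_one_iff]

theorem count_two_block_markOne (h : ∀ i, v i = 1 ↔ v (i + 1) = 2) (k n : ℕ) :
    (block v (k + 1) n).count 2 = (block (markOne v) k n).count 1 := by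
  induction n with
  | zero => rfl
  | succ n ih =>
    simp only [count_block_succ, ih, markOne_eq_one_iff, h]
    rw [add_right_comm]

theorem count_markOne_two_le (h : ∀ i, v i = 1 ↔ v (i + 1) = 2) (k : ℕ) :
    (block (markOne v) k 2).count 1 ≤ 1 := by
  rw [count_block_succ, count_block_succ]
  simp only [markOne_eq_one_iff, block_zero, List.count_nil]
  have h1 := h k
  split_ifs with h2 h3
  · rw [Nat.add_zero] at h2
    rw [h1.1 h2] at h3
    exact absurd h3 (by decide)
  all_goals simp

end Marking

/-! ### Uniform recurrence and minimal subshifts. -/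

section Minimal

/-- A word is uniformly recurrent if each of its factors occurs with bounded gaps. -/
def UniformlyRecurrent {A : Type*} (x : ℕ → A) : Prop :=
  ∀ k n, ∃ N, ∀ q, ∃ j ≤ N, ∀ i < n, x (q + j + i) = x (k + i)

theorem UniformlyRecurrent.comp {A B : Type*} {x : ℕ → A} (h : UniformlyRecurrent x) (f : A → B) :
    UniformlyRecurrent fun i => f (x i) := by
  intro k n
  obtain ⟨N, hN⟩ := h k n
  refine ⟨N, fun q => ?_⟩
  obtain ⟨j, hj, e⟩ := hN q
  exact ⟨j, hj, fun i hi => congrArg f (e i hi)⟩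

variable {A : Type*} [TopologicalSpace A] [DiscreteTopology A]

theorem mem_closure_iff_forall_prefix {X : Set (ℕ → A)} {z : ℕ → A} :
    z ∈ closure X ↔ ∀ n, ∃ w ∈ X, ∀ i < n, w i = z i := by
  rw [(PiNat.isTopologicalBasis_cylinders fun _ : ℕ => A).mem_closure_iff]
  constructor
  · intro h n
    obtain ⟨w, hw, hX⟩ := h _ ⟨z, n, rfl⟩ (PiNat.self_mem_cylinder z n)
    exact ⟨w, hX, PiNat.mem_cylinder_iff.1 hw⟩
  · rintro h _ ⟨x, n, rfl⟩ hz
    obtain ⟨w, hw, e⟩ := h n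
    refine ⟨w, PiNat.mem_cylinder_iff.2 fun i hi => ?_, hw⟩
    rw [e i hi]
    exact PiNat.mem_cylinder_iff.1 hz i hi

theorem isSubshift_orbitClosure (x : ℕ → A) : IsSubshift (orbitClosure x) := by
  refine ⟨⟨x, Set.Subset.rfl⟩, isClosed_of_closure_subset fun z hz => ?_, fun y hy => ?_⟩
  · rw [mem_closure_iff_forall_prefix] at hz
    rw [mem_orbitClosure_iff]
    intro k n
    obtain ⟨w, hw, e⟩ := hz (k + n)
    obtain ⟨j, hj⟩ := mem_orbitClosure_iff.1 hw k n
    exact ⟨j, fun i hi => by rw [← e _ (by omega), hj i hi]⟩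
  · rw [mem_orbitClosure_iff] at hy ⊢
    intro k n
    obtain ⟨j, hj⟩ := hy (k + 1) n
    refine ⟨j, fun i hi => ?_⟩
    rw [← hj i hi, shift]
    congr 1
    omega

/-- The orbit closure of a uniformly recurrent word is a minimal subshift. -/
theorem UniformlyRecurrent.isMinimalSubshift {x : ℕ → A} (hx : UniformlyRecurrent x) :
    IsMinimalSubshift (orbitClosure x) := by
  refine ⟨isSubshift_orbitClosure x, fun Y hY hYX => Set.Subset.antisymm hYX fun z hz => ?_⟩
  obtain ⟨⟨y, hy⟩, hclosed, hshift⟩ := hY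
  rw [← hclosed.closure_eq, mem_closure_iff_forall_prefix]
  intro n
  obtain ⟨k, hk⟩ := mem_orbitClosure_iff.1 hz 0 n
  obtain ⟨N, hN⟩ := hx k n
  -- The prefix of `y` of length `N + n` is a factor of `x`, long enough to contain the required
  -- prefix of `z`.
  obtain ⟨q, hq⟩ := mem_orbitClosure_iff.1 (hYX hy) 0 (N + n)
  obtain ⟨j, hj, e⟩ := hN q
  have hiter : ∀ m, (fun i => y (m + i)) ∈ Y := by
    intro m
    induction m with
    | zero => simpa using hy
    | succ m ih =>
      convert hshift _ ih using 1
      funext i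
      simp only [shift]
      congr 1
      omega
  refine ⟨_, hiter j, fun i hi => ?_⟩
  have h1 := hq (j + i) (by omega)
  have h2 := hk i hi
  rw [Nat.zero_add] at h1 h2
  rw [h1, h2, ← e i hi, add_assoc]

end Minimal

/-! ### Codings of irrational rotations by two arcs. -/

section Rotation

/-- Every orbit of an irrational rotation visits each interval `[x, x + ε)` within a time that
depends on `ε` only. -/
theorem exists_rotation_visit {γ ε : ℝ} (hγ : Irrational γ) (hε : 0 < ε) :
    ∃ N : ℕ, ∀ z x : ℝ, ∃ j ≤ N, ∃ m : ℤ, x ≤ z + j * γ - m ∧ z + j * γ - m < x + ε := by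
  obtain ⟨n, hn⟩ := exists_nat_one_div_lt hε
  -- By Dirichlet, `k` rotations amount to a nonzero displacement `θ` shorter than `ε`, which cannot
  -- jump over the target; `1 / |θ|` such displacements go round the circle.
  obtain ⟨k, hk, -, hk'⟩ := Real.exists_nat_abs_mul_sub_round_le γ (Nat.succ_pos n)
  set r : ℤ := round (k * γ) with hr
  set θ : ℝ := k * γ - r with hθ
  have hθε : |θ| < ε := by
    refine hk'.trans_lt (lt_of_le_of_lt ?_ hn)
    apply one_div_le_one_div_of_le (by positivity)
    push_cast
    linarith
  have hθ0 : θ ≠ 0 := ((hγ.natCast_mul hk.ne').sub_intCast r).ne_zero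
  have hpos : 0 < |θ| := abs_pos.2 hθ0
  refine ⟨⌈1 / |θ|⌉₊ * k, fun z x => ?_⟩
  have hmul : ∀ i : ℕ, ((i * k : ℕ) : ℝ) * γ = i * θ + (i * r : ℤ) := fun i => by
    rw [hθ]
    push_cast
    ring
  rcases hθ0.lt_or_gt with hneg | hpos'
  · rw [abs_of_neg hneg] at *
    set c := Int.fract (z - x) with hc
    have hc0 : 0 ≤ c := Int.fract_nonneg _
    have hc1 : c < 1 := Int.fract_lt_one _
    have hcz : z - x = ⌊z - x⌋ + c := (Int.floor_add_fract _).symm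
    have h1 := Nat.floor_le (div_nonneg hc0 hpos.le)
    have h2 := Nat.lt_floor_add_one (c / -θ)
    rw [le_div_iff₀ hpos] at h1
    rw [div_lt_iff₀ hpos] at h2
    refine ⟨⌊c / -θ⌋₊ * k, Nat.mul_le_mul_right k ?_,
      ⌊z - x⌋ + (⌊c / -θ⌋₊ * r : ℤ), ?_⟩
    · refine (Nat.floor_le_floor ?_).trans (Nat.floor_le_ceil _)
      exact div_le_div_of_nonneg_right hc1.le hpos.le
    · rw [hmul]
      rw [Int.cast_add]
      constructor <;> linarith
  · rw [abs_of_pos hpos'] at *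
    set c := Int.fract (x - z) with hc
    have hc0 : 0 ≤ c := Int.fract_nonneg _
    have hc1 : c < 1 := Int.fract_lt_one _
    have hcz : x - z = ⌊x - z⌋ + c := (Int.floor_add_fract _).symm
    have h1 := Nat.le_ceil (c / θ)
    have h2 := Nat.ceil_lt_add_one (div_nonneg hc0 hpos.le)
    rw [div_le_iff₀ hpos] at h1
    have h3 : (⌈c / θ⌉₊ : ℝ) * θ < c + θ := by
      have := mul_lt_mul_of_pos_right h2 hpos
      rwa [add_mul, div_mul_cancel₀ _ hpos.ne', one_mul] at this
    refine ⟨⌈c / θ⌉₊ * k, Nat.mul_le_mul_right k ?_,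
      -⌊x - z⌋ + (⌈c / θ⌉₊ * r : ℤ), ?_⟩
    · exact Nat.ceil_le_ceil (div_le_div_of_nonneg_right hc1.le hpos.le)
    · rw [hmul]
      rw [Int.cast_add, Int.cast_neg]
      constructor <;> linarith

/-- The coding of the point `x` of the circle `ℝ / ℤ` by two half-open arcs of length `γ`. -/
noncomputable def rotLetter (γ δ x : ℝ) : Fin 3 :=
  if ⌊x + γ⌋ ≠ ⌊x⌋ then 1 else if ⌊x + δ + γ⌋ ≠ ⌊x + δ⌋ then 2 else 0

/-- The coding of the orbit of `0` under the rotation by `γ`. -/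
noncomputable def rotWord (γ δ : ℝ) (i : ℕ) : Fin 3 := rotLetter γ δ (i * γ)

theorem rotLetter_sub_intCast (γ δ x : ℝ) (m : ℤ) :
    rotLetter γ δ (x - m) = rotLetter γ δ x := by
  have h : ∀ y : ℝ, ⌊y - m⌋ = ⌊y⌋ - m := fun y => Int.floor_sub_intCast y m
  rw [rotLetter, rotLetter, show x - m + γ = x + γ - m by ring,
    show x - m + δ + γ = x + δ + γ - m by ring, show x - m + δ = x + δ - m by ring]
  simp only [h, ne_eq, sub_left_inj]

open Filter Topology in
-- The floor is only right-continuous, so recurrence of the coding is derived from visits to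
-- half-open intervals to the right of a point.
theorem eventually_floor_add_eq (x c : ℝ) : ∀ᶠ x' in 𝓝[≥] x, ⌊x' + c⌋ = ⌊x + c⌋ := by
  have h : x < ⌊x + c⌋ + 1 - c := by linarith [Int.lt_floor_add_one (x + c)]
  filter_upwards [Ico_mem_nhdsGE h] with x' hx'
  rw [Int.floor_eq_iff]
  constructor <;> linarith [hx'.1, hx'.2, Int.floor_le (x + c)]

open Filter Topology in
theorem eventually_rotLetter_eq (γ δ x c : ℝ) :
    ∀ᶠ x' in 𝓝[≥] x, rotLetter γ δ (x' + c) = rotLetter γ δ (x + c) := by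
  filter_upwards [eventually_floor_add_eq x c, eventually_floor_add_eq x (c + γ),
    eventually_floor_add_eq x (c + δ), eventually_floor_add_eq x (c + δ + γ)] with x' h1 h2 h3 h4
  simp only [← add_assoc] at h2 h3 h4
  rw [rotLetter, rotLetter, h1, h2, h3, h4]

theorem uniformlyRecurrent_rotWord {γ : ℝ} (hγ : Irrational γ) (δ : ℝ) :
    UniformlyRecurrent (rotWord γ δ) := by
  intro k n
  have h1 := (Filter.eventually_all_finset (Finset.range n)).2 fun i _ =>
    eventually_rotLetter_eq γ δ (k * γ) (i * γ)
  obtain ⟨b, hb, hsub⟩ := mem_nhdsGE_iff_exists_Ico_subset.1 h1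
  obtain ⟨N, hN⟩ := exists_rotation_visit hγ (sub_pos.2 hb)
  refine ⟨N, fun q => ?_⟩
  obtain ⟨j, hj, m, h2, h3⟩ := hN (q * γ) (k * γ)
  refine ⟨j, hj, fun i hi => ?_⟩
  have h4 := hsub ⟨h2, by linarith⟩ i (Finset.mem_range.2 hi)
  rw [rotWord, rotWord]
  push_cast
  rw [add_mul, add_mul, add_mul, ← h4, ← rotLetter_sub_intCast γ δ _ m]
  congr 1
  ring

theorem floor_add_ne_iff {γ : ℝ} (h0 : 0 < γ) (h1 : γ < 1) (x : ℝ) :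
    ⌊x + γ⌋ ≠ ⌊x⌋ ↔ ∃ m : ℤ, m + 1 - γ ≤ x ∧ x < m + 1 := by
  constructor
  · intro h
    refine ⟨⌊x⌋, ?_, Int.lt_floor_add_one x⟩
    by_contra! hlt
    refine h (Int.floor_eq_iff.2 ⟨?_, ?_⟩) <;> linarith [Int.floor_le x]
  · rintro ⟨m, h2, h3⟩ h
    have e1 : ⌊x⌋ = m := Int.floor_eq_iff.2 ⟨by linarith, h3⟩
    have e2 : ⌊x + γ⌋ = m + 1 := Int.floor_eq_iff.2 (by push_cast; constructor <;> linarith)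
    omega

theorem floor_add_eq_of_mem {γ x : ℝ} {m : ℤ} (h0 : 0 < γ) (h2 : m ≤ x) (h3 : x + γ < m + 1) :
    ⌊x + γ⌋ = ⌊x⌋ := by
  rw [Int.floor_eq_iff.2 ⟨h2, by linarith⟩, Int.floor_eq_iff]
  constructor <;> linarith

variable {γ δ : ℝ}

theorem rotLetter_eq_one_iff (x : ℝ) : rotLetter γ δ x = 1 ↔ ⌊x + γ⌋ ≠ ⌊x⌋ := by
  unfold rotLetter
  split_ifs <;> simp_all

/-- The bounds on `δ` make the arcs disjoint, so the priority of `1` in the definition never hides a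
`2`. -/
theorem rotLetter_eq_two_iff (h0 : 0 < γ) (h1 : γ ≤ δ) (h2 : δ ≤ 1 - γ) (x : ℝ) :
    rotLetter γ δ x = 2 ↔ ⌊x + δ + γ⌋ ≠ ⌊x + δ⌋ := by
  unfold rotLetter
  split_ifs with h3 h4
  · obtain ⟨m, h5, h6⟩ := (floor_add_ne_iff h0 (by linarith) x).1 h3
    have : ⌊x + δ + γ⌋ = ⌊x + δ⌋ :=
      floor_add_eq_of_mem (m := m + 1) h0 (by push_cast; linarith) (by push_cast; linarith)
    simp [this]
  · simp [h4]
  · simp [not_not.1 h4]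

theorem floor_add_cases {θ : ℝ} {f : ℕ} (h0 : (f : ℝ) ≤ θ) (h1 : θ < f + 1) (x : ℝ) :
    ⌊x + θ⌋ = ⌊x⌋ + f ∨ ⌊x + θ⌋ = ⌊x⌋ + f + 1 := by
  have h2 := Int.floor_le x
  have h3 := Int.lt_floor_add_one x
  have h4 := Int.floor_le (x + θ)
  have h5 := Int.lt_floor_add_one (x + θ)
  have h6 : (⌊x⌋ : ℝ) + f < ⌊x + θ⌋ + 1 := by linarith
  have h7 : (⌊x + θ⌋ : ℝ) < ⌊x⌋ + f + 2 := by linarith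
  norm_cast at h6 h7
  omega

/-- Written as a difference of floors, the indicator of an arc telescopes along the orbit. -/
theorem ite_floor_add_eq (h0 : 0 < γ) (h1 : γ < 1) (x : ℝ) :
    ((if ⌊x + γ⌋ ≠ ⌊x⌋ then 1 else 0 : ℕ) : ℤ) = ⌊x + γ⌋ - ⌊x⌋ := by
  have := floor_add_cases (f := 0) (by simpa using h0.le) (by simpa using h1) x
  split_ifs <;> push_cast at this ⊢ <;> omega

theorem count_one_rotWord (h0 : 0 < γ) (h1 : γ < 1) (k n : ℕ) :
    ((block (rotWord γ δ) k n).count 1 : ℤ) = ⌊k * γ + n * γ⌋ - ⌊k * γ⌋ := by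
  induction n with
  | zero => simp
  | succ n ih =>
    rw [count_block_succ, Nat.cast_add, ih]
    simp only [rotWord, rotLetter_eq_one_iff]
    rw [ite_floor_add_eq h0 h1]
    push_cast
    rw [add_mul, add_mul, one_mul, add_assoc (k * γ)]
    ring

theorem count_two_rotWord (h0 : 0 < γ) (h1 : γ ≤ δ) (h2 : δ ≤ 1 - γ) (k n : ℕ) :
    ((block (rotWord γ δ) k n).count 2 : ℤ) = ⌊k * γ + δ + n * γ⌋ - ⌊k * γ + δ⌋ := by
  induction n with
  | zero => simp
  | succ n ih =>
    rw [count_block_succ, Nat.cast_add, ih]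
    simp only [rotWord, rotLetter_eq_two_iff h0 h1 h2]
    rw [ite_floor_add_eq h0 (by linarith)]
    push_cast
    rw [show k * γ + δ + (n + 1) * γ = (k + n) * γ + δ + γ by ring,
      show k * γ + δ + n * γ = (k + n) * γ + δ by ring]
    ring

theorem orbitClosure_subset_of_mem_abelianClosure {A : Type*} [DecidableEq A] {x y : ℕ → A}
    (hy : y ∈ abelianClosure x) : orbitClosure y ⊆ abelianClosure x :=
  fun _ hz w hw => hy w (hz hw)

/-- For a suitable distance `j`, a `1` followed `j` places later by a `2` occurs with offset `δ` but
never with `δ'`: modulo 1, `δ + j * γ` lies just below `γ`, so the arcs of `1` and of the `2` to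
come barely overlap, and the larger offset separates them. -/
theorem rotWord_ne_of_lt (hγ : Irrational γ) {δ' : ℝ} (h0 : 0 < γ) (h1 : γ ≤ δ) (h2 : δ' ≤ 1 - γ)
    (hlt : δ < δ') : rotWord γ δ ∉ orbitClosure (rotWord γ δ') := by
  intro hmem
  set η := min (δ' - δ) (γ / 2) with hη
  have hη0 : 0 < η := lt_min (sub_pos.2 hlt) (half_pos h0)
  have hη1 : η ≤ δ' - δ := min_le_left _ _
  have hη2 : η ≤ γ / 2 := min_le_right _ _
  obtain ⟨_, hvisit⟩ := exists_rotation_visit hγ hη0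
  obtain ⟨j, -, m, h3, h4⟩ := hvisit δ (γ - η)
  set w := δ + j * γ - m with hw
  obtain ⟨_, hvisit'⟩ := exists_rotation_visit (ε := γ - w) hγ (by linarith)
  obtain ⟨k, -, m', h5, h6⟩ := hvisit' 0 (1 - γ)
  have hγ1 : γ < 1 := by linarith
  have e1 : rotWord γ δ k = 1 := by
    rw [rotWord, rotLetter_eq_one_iff, floor_add_ne_iff h0 hγ1]
    exact ⟨m', by linarith, by linarith⟩
  have e2 : rotWord γ δ (k + j) = 2 := by
    rw [rotWord, rotLetter_eq_two_iff h0 h1 (by linarith), floor_add_ne_iff h0 hγ1]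
    refine ⟨m' + m, ?_⟩
    push_cast
    constructor <;> linarith
  obtain ⟨l, hl⟩ := mem_orbitClosure_iff.1 hmem k (j + 1)
  have e3 := hl 0 (by omega)
  have e4 := hl j (by omega)
  rw [Nat.add_zero, Nat.add_zero, e1, rotWord, eq_comm, rotLetter_eq_one_iff,
    floor_add_ne_iff h0 hγ1] at e3
  obtain ⟨a, h7, h8⟩ := e3
  rw [e2, rotWord, eq_comm, rotLetter_eq_two_iff h0 (by linarith) h2] at e4
  refine e4 (floor_add_eq_of_mem (m := a + 1 + m) h0 ?_ ?_)
  all_goals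
    push_cast
    linarith

/-- The coded words lie in the abelian closure of any word in which the `2`s are exactly the
successors of the `1`s and the `1`s form a word of slope `γ`. -/
theorem rotWord_mem_abelianClosure {v : ℕ → Fin 3} (h : ∀ i, v i = 1 ↔ v (i + 1) = 2)
    (hγ : ∀ n : ℕ, 1 ≤ n → ∃ f : ℕ, (f : ℝ) < n * γ ∧ n * γ < f + 1 ∧
      (∀ p, (block (markOne v) p n).count 1 = f ∨ (block (markOne v) p n).count 1 = f + 1) ∧
      (∀ N, ∃ p ≥ N, (block (markOne v) p n).count 1 = f) ∧
      ∀ N, ∃ p ≥ N, (block (markOne v) p n).count 1 = f + 1)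
    (h0 : 0 < γ) (h1 : γ ≤ δ) (h2 : δ ≤ 1 - γ) : rotWord γ δ ∈ abelianClosure v := by
  rw [mem_abelianClosure_iff]
  intro k n
  rcases Nat.eq_zero_or_pos n with rfl | hn
  · exact ⟨0, fun a => rfl⟩
  obtain ⟨f, hf, hf', -⟩ := hγ n hn
  have c1 := count_one_rotWord (δ := δ) h0 (by linarith) k n
  have c2 := count_two_rotWord h0 h1 h2 k n
  set x : ℝ := k * γ
  set θ : ℝ := n * γ
  have d1 := floor_add_cases hf.le hf' x
  have d2 := floor_add_cases hf.le hf' (x + δ)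
  have b1 := Int.floor_le x
  have b2 := Int.lt_floor_add_one x
  have b3 := Int.floor_le (x + δ)
  have b4 := Int.lt_floor_add_one (x + δ)
  have b5 := Int.floor_le (x + θ)
  have b6 := Int.lt_floor_add_one (x + θ)
  have b7 := Int.floor_le (x + δ + θ)
  have b8 := Int.lt_floor_add_one (x + δ + θ)
  obtain ⟨p, hp1, hp2⟩ := exists_consecutive_counts hγ hn hf hf'
    (l := (block (rotWord γ δ) k n).count 1) (m := (block (rotWord γ δ) k n).count 2)
    (by omega) (by omega)
    -- A count is `f + 1` when the fractional part of the starting point lies in the last `θ - f` of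
    -- the unit interval. If that length is at most `γ`, two points at distance `δ` in `[γ, 1 - γ]`
    -- cannot both lie there. For two light counts the same applies to the complementary arc.
    (fun e1 e2 => by
      by_contra! hle
      have g1 : ⌊x + θ⌋ = ⌊x⌋ + f + 1 := by omega
      have g2 : ⌊x + δ + θ⌋ = ⌊x + δ⌋ + f + 1 := by omega
      rw [g1] at b5
      rw [g2] at b7
      push_cast at b5 b7
      have g3 : ⌊x⌋ + 1 ≤ ⌊x + δ⌋ := Int.le_floor.2 (by push_cast; linarith)
      have g4 : (⌊x⌋ + 1 : ℝ) ≤ ⌊x + δ⌋ := by exact_mod_cast g3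
      linarith)
    (fun e1 e2 => by
      by_contra! hle
      have g1 : ⌊x + θ⌋ = ⌊x⌋ + f := by omega
      have g2 : ⌊x + δ + θ⌋ = ⌊x + δ⌋ + f := by omega
      rw [g1] at b6
      rw [g2] at b8
      push_cast at b6 b8
      have g3 : ⌊x + δ⌋ < ⌊x⌋ + 1 := Int.floor_lt.2 (by push_cast; linarith)
      have g4 : (⌊x + δ⌋ : ℝ) ≤ ⌊x⌋ := by exact_mod_cast Int.lt_add_one_iff.1 g3
      linarith)
  rw [← count_one_block_markOne] at hp2
  rw [← count_two_block_markOne h] at hp1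
  have s1 := count_add_count_add_count (block (rotWord γ δ) k n)
  have s2 := count_add_count_add_count (block v (p + 1) n)
  rw [length_block] at s1 s2
  refine ⟨p + 1, fun a => ?_⟩
  fin_cases a
  · change (block (rotWord γ δ) k n).count 0 = (block v (p + 1) n).count 0
    omega
  · exact hp2.symm
  · exact hp1.symm

end Rotation

/-! ### Uncountably many minimal subshifts. -/

section TypeThree

theorem UpToPerm.not_countable_minimalSubshifts {u : ℕ → Fin 3}
    (hu : ∀ n, 1 ≤ n → complexity u n = n + 2) (h : UpToPerm IsTypeThree u) :
    ¬ {X : Set (ℕ → Fin 3) | IsMinimalSubshift X ∧ X ⊆ abelianClosure u}.Countable := by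
  obtain ⟨π, s, -, hs⟩ := h
  set v : ℕ → Fin 3 := fun n => π (u n) with hvu
  have hv : ∀ i, v i = 1 ↔ v (i + 1) = 2 := rel_of_mem_orbitClosure
    (R := fun a b => a = 1 ↔ b = 2) (morphicImage_rel morphB_ne_nil isChain_flatMap_morphB s) hs
  obtain ⟨γ, hirr, hγ⟩ := (isSturmian_markOne hv fun n hn => by
    rw [hvu, complexity_comp π.injective, hu n hn]).exists_slope
  have h0 : 0 < γ := by
    obtain ⟨f, hf, -⟩ := hγ 1 le_rfl
    have : (0 : ℝ) ≤ f := Nat.cast_nonneg f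
    push_cast at hf
    linarith
  -- No two `1`s are adjacent, so windows of length 2 have 0 or 1 ones and `2 * γ < 1`; the interval
  -- of offsets is thus nondegenerate.
  have h1 : γ < 1 - γ := by
    obtain ⟨f, -, hf, -, -, hf'⟩ := hγ 2 (by omega)
    obtain ⟨p, -, hp⟩ := hf' 0
    have := count_markOne_two_le hv p
    obtain rfl : f = 0 := by omega
    push_cast at hf
    linarith
  have huv : (fun i => π.symm (v i)) = u := by
    funext i
    simp [hvu]
  intro hcount
  have hmaps : Set.MapsTo (fun δ => orbitClosure fun i => π.symm (rotWord γ δ i))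
      (Set.Icc γ (1 - γ))
      {X : Set (ℕ → Fin 3) | IsMinimalSubshift X ∧ X ⊆ abelianClosure u} := by
    intro δ hδ
    refine ⟨((uniformlyRecurrent_rotWord hirr δ).comp π.symm).isMinimalSubshift,
      orbitClosure_subset_of_mem_abelianClosure ?_⟩
    have := comp_mem_abelianClosure (f := π.symm)
      (rotWord_mem_abelianClosure hv hγ h0 hδ.1 hδ.2)
    rwa [huv] at this
  have hinj : Set.InjOn (fun δ => orbitClosure fun i => π.symm (rotWord γ δ i))
      (Set.Icc γ (1 - γ)) := by
    intro δ hδ δ' hδ' e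
    by_contra hne
    wlog hlt : δ < δ' generalizing δ δ'
    · exact this hδ' hδ e.symm (Ne.symm hne) (lt_of_le_of_ne (not_lt.1 hlt) (Ne.symm hne))
    refine rotWord_ne_of_lt hirr h0 hδ.1 hδ'.2 hlt ?_
    rw [← comp_mem_orbitClosure_iff π.symm.injective]
    simp only at e
    rw [← e]
    exact Set.Subset.rfl
  have := hmaps.countable_of_injOn hinj hcount
  rw [Cardinal.Real.Icc_countable_iff] at this
  linarith

end TypeThree

end InfWord

theorem mainTheorem3 (u : ℕ → Fin 3)
    (hu : ∀ n : ℕ, 1 ≤ n → InfWord.complexity u n = n + 2) :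
    ((InfWord.UpToPerm InfWord.IsTypeOne u ∨ InfWord.UpToPerm InfWord.IsTypeTwo u) →
      InfWord.abelianClosure u = InfWord.orbitClosure u) ∧
    (InfWord.UpToPerm InfWord.IsTypeThree u →
      ¬ {X : Set (ℕ → Fin 3) |
          InfWord.IsMinimalSubshift X ∧ X ⊆ InfWord.abelianClosure u}.Countable) := by
  refine ⟨?_, fun h => h.not_countable_minimalSubshifts hu⟩
  rintro (h | h)
  · exact h.abelianClosure_eq fun v _ hv => hv.abelianClosure_eq
  · exact h.abelianClosure_eq fun v hc hv =>
      hv.abelianClosure_eq fun n hn => by rw [hc, hu n hn]
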